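/- Let $\zeta_0,\zeta_1,\zeta_2,\dots$ be independent standard complex Gaussian random variables (each with density $\pi^{-1}e^{-|w|^2}$ with respect to Lebesgue measure on $\mathbb C$), and let $$\psi(z)=\sum_{k=0}^\infty \zeta_k\,\frac{z^k}{\sqrt{k!}},\qquad z\in\mathbb C,$$ which is almost surely an entire function. For $r>0$ let $n(r)$ be the number of zeros of $\psi$, counted with multiplicity, in the closed disc $\{|z|\le r\}$. For every $\delta\in(0,\tfrac14]$ there is a constant $c(\delta)>0$, depending only on $\delta$, such that $$\mathbb P\left(\left|\frac{n(r)}{r^2}-1\right|\ge\delta\right)\le \exp\left(-c(\delta)\,r^4\right)$$ for every $r\ge 1$ for which there is an integer $m\ge 0$ with $\left|\frac{m}{r^2}-1\right|<\delta$ (in particular for every $r\ge1$ with $\delta r^2>\tfrac12$). For the remaining $r$ the event on the left-hand side is the whole probability space, because $n(r)$ is an integer. -/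

import Mathlib

open MeasureTheory ProbabilityTheory

/-- The standard complex Gaussian distribution: density `π⁻¹ exp (-|w|²)` with respect to
Lebesgue measure on `ℂ`. -/
noncomputable def stdComplexGaussian : Measure ℂ :=
  volume.withDensity fun w => ENNReal.ofReal (Real.pi⁻¹ * Real.exp (-‖w‖ ^ 2))

/-- The power series `∑ k, a k * z ^ k / √(k!)`. -/
noncomputable def gaussianSeries (a : ℕ → ℂ) (z : ℂ) : ℂ :=
  ∑' k : ℕ, a k * (z ^ k / (Real.sqrt (Nat.factorial k : ℝ) : ℂ))

/-- The number of zeros of `f` in the closed disc `|z| ≤ r`, counted with multiplicity. -/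
noncomputable def zeroCount (f : ℂ → ℂ) (r : ℝ) : ℕ :=
  ∑ᶠ z ∈ Metric.closedBall (0 : ℂ) r, analyticOrderNatAt f z

/-!
Write `A(R)` for the mean of `log |ψ|` over the circle `|z| = R`. By Jensen's formula
(`zeroCount_mul_log_le`) the increment `A(R₂) - A(R₁)` lies between `n(R₁) log (R₂ / R₁)` and
`n(R₂) log (R₂ / R₁)`, so `n(r)` is close to `r²` as soon as `A(R)` is close to `R² / 2` at the three
radii `r e⁻ᵗ`, `r`, `r eᵗ` for a small `t` depending on `δ` (`abs_zeroCount_div_lt`). It remains to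
bound the two tails of `A(r)`.

*Upper tail.* `A(r)` is at most the logarithm of `∑ k, |ζ k| r ^ k / √(k!)`. The sum of the weights
is `exp ((1 / 2 + o(1)) r²)`, and by convexity the normalised sum has an exponential moment bounded
by `E exp |ζ|`; Markov's inequality gives a doubly exponential bound (`measure_le_logMean`).

*Lower tail.* Let `n` be about `η r² / 4` and let `z j` be `n` equispaced points of the circle. In
the block of `n` consecutive coefficients just above the maximal term `k ≈ r²`, all weights are
`exp ((1 / 2 - O(η)) r²)`, and the map from these coefficients to the values at the points `z j` is a
diagonal matrix followed by `√n` times a unitary one. Conditionally on the other coefficients the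
vector `(ψ(z j))` therefore has a density so small that `E ∏ j, |ψ(z j)|⁻¹` is at most
`exp (-(1 / 2 - O(η)) n r²)` (`lintegral_prod_inv_le`, `lintegral_prod_inv_partialSum_le`). Rotating
the points and using Jensen's inequality, the same bound holds for `E exp (-n A(r))`; since `n` is of
order `r²`, Markov's inequality gives the decay `exp (-c r⁴)` (`measure_logMean_le`).

These estimates hold for large `r`. For bounded `r ≥ 1` it is enough that every count `m` has
probability bounded below, uniformly in `r`: this happens when the single coefficient `ζ m` is huge
compared with all other terms (`exists_measure_zeroCount_ne_le`).

All estimates are made for the product measure `gaussianSeq` on sequences, to which the law of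
`(ζ k)` is equal.
-/

/-! ### Entire functions and Jensen's formula -/

/-- The coefficient sequences for which `gaussianSeries` converges absolutely on all of `ℂ`. -/
def RapidDecay (a : ℕ → ℂ) : Prop :=
  ∀ R : ℝ, 0 ≤ R → Summable fun k : ℕ => ‖a k‖ * (R ^ k / Real.sqrt (Nat.factorial k : ℝ))

lemma norm_gaussianSeries_term (a : ℕ → ℂ) (z : ℂ) (k : ℕ) :
    ‖a k * (z ^ k / (Real.sqrt (Nat.factorial k : ℝ) : ℂ))‖
      = ‖a k‖ * (‖z‖ ^ k / Real.sqrt (Nat.factorial k : ℝ)) := by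
  rw [norm_mul, norm_div, norm_pow, Complex.norm_real, Real.norm_of_nonneg (Real.sqrt_nonneg _)]

lemma RapidDecay.summable {a : ℕ → ℂ} (ha : RapidDecay a) (z : ℂ) :
    Summable fun k : ℕ => a k * (z ^ k / (Real.sqrt (Nat.factorial k : ℝ) : ℂ)) := by
  refine Summable.of_norm ?_
  simpa only [norm_gaussianSeries_term] using ha ‖z‖ (norm_nonneg z)

lemma RapidDecay.differentiable {a : ℕ → ℂ} (ha : RapidDecay a) :
    Differentiable ℂ (gaussianSeries a) := by
  intro z
  have hU : IsOpen (Metric.ball (0 : ℂ) (‖z‖ + 1)) := Metric.isOpen_ball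
  have hd : DifferentiableOn ℂ (gaussianSeries a) (Metric.ball (0 : ℂ) (‖z‖ + 1)) := by
    refine Complex.differentiableOn_tsum_of_summable_norm (ha (‖z‖ + 1) (by positivity))
      (fun k => ?_) hU (fun k w hw => ?_)
    · fun_prop
    · rw [norm_gaussianSeries_term]
      have : ‖w‖ ≤ ‖z‖ + 1 := by simpa using (Metric.mem_ball.1 hw).le
      gcongr
  exact hd.differentiableAt (hU.mem_nhds (by simp))

/-- The circle average of `log ‖f‖` over `|z| = R`. -/
noncomputable def logMean (f : ℂ → ℂ) (R : ℝ) : ℝ :=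
  Real.circleAverage (fun z => Real.log ‖f z‖) 0 R

lemma divisor_eq_ite {f : ℂ → ℂ} (hf : Differentiable ℂ f) (R : ℝ) (u : ℂ) :
    (MeromorphicOn.divisor f (Metric.closedBall 0 R) u : ℝ)
      = if ‖u‖ ≤ R then (analyticOrderNatAt f u : ℝ) else 0 := by
  have hA : AnalyticOnNhd ℂ f (Metric.closedBall 0 R) := fun z _ => hf.analyticAt z
  split_ifs with h
  · rw [MeromorphicOn.AnalyticOnNhd.divisor_apply hA (by simpa using h)]
    simp only [analyticOrderNatAt]
    cases analyticOrderAt f u with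
    | top => simp
    | coe n => simp
  · rw [Function.locallyFinsuppWithin.apply_eq_zero_of_notMem _ (by simpa using h)]
    simp

lemma finite_zeros {f : ℂ → ℂ} (hf : Differentiable ℂ f) (R : ℝ) :
    (Function.support fun u : ℂ => if ‖u‖ ≤ R then (analyticOrderNatAt f u : ℝ) else 0).Finite := by
  refine ((MeromorphicOn.divisor f (Metric.closedBall 0 R)).finiteSupport
    (isCompact_closedBall 0 R)).subset fun u hu => ?_
  rw [Function.mem_support, ← divisor_eq_ite hf] at hu
  simpa using hu

lemma zeroCount_eq_finsum {f : ℂ → ℂ} (hf : Differentiable ℂ f) (R : ℝ) :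
    (zeroCount f R : ℝ) = ∑ᶠ u : ℂ, if ‖u‖ ≤ R then (analyticOrderNatAt f u : ℝ) else 0 := by
  have hfin := finite_zeros hf R
  have : zeroCount f R = ∑ᶠ u : ℂ, if ‖u‖ ≤ R then analyticOrderNatAt f u else 0 := by
    unfold zeroCount
    refine finsum_congr fun u => ?_
    by_cases hu : ‖u‖ ≤ R <;> simp [hu]
  rw [this]
  have h2 := (Nat.castRingHom ℝ).toAddMonoidHom.map_finsum
    (f := fun u : ℂ => if ‖u‖ ≤ R then analyticOrderNatAt f u else 0) (hfin.subset fun u hu => by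
      simp only [Function.mem_support] at hu ⊢
      exact_mod_cast hu)
  refine Eq.trans h2 (finsum_congr fun u => ?_)
  split_ifs <;> simp

/-- Jensen's formula written with the multiplicities `analyticOrderNatAt`. -/
lemma logMean_eq {f : ℂ → ℂ} (hf : Differentiable ℂ f) {R : ℝ} (hR : 0 < R) :
    logMean f R = ∑ᶠ u : ℂ, (if ‖u‖ ≤ R then (analyticOrderNatAt f u : ℝ) else 0)
        * Real.log (R * ‖u‖⁻¹)
      + analyticOrderNatAt f 0 * Real.log R + Real.log ‖meromorphicTrailingCoeffAt f 0‖ := by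
  have h := MeromorphicOn.circleAverage_log_norm (c := 0) (f := f) hR.ne'
    (fun z _ => (hf.analyticAt z).meromorphicAt)
  rw [abs_of_pos hR] at h
  simp only [divisor_eq_ite hf, norm_zero, hR.le, if_true, zero_sub, norm_neg] at h
  exact h

/-- Two-sided form of Jensen's formula: in the increment of `logMean` between the radii `R₁ < R₂`,
each zero of the smaller disc contributes `log (R₂ / R₁)`, and each zero of the annulus contributes
between `0` and `log (R₂ / R₁)`. The zero function is included, both sides being `0`. -/
lemma zeroCount_mul_log_le {f : ℂ → ℂ} (hf : Differentiable ℂ f) {R₁ R₂ : ℝ} (h₁ : 0 < R₁)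
    (h₂ : R₁ < R₂) :
    zeroCount f R₁ * Real.log (R₂ / R₁) ≤ logMean f R₂ - logMean f R₁ ∧
      logMean f R₂ - logMean f R₁ ≤ zeroCount f R₂ * Real.log (R₂ / R₁) := by
  have h₂' : 0 < R₂ := h₁.trans h₂
  set m : ℂ → ℝ := fun u => (analyticOrderNatAt f u : ℝ) with hm
  have hm0 : ∀ u, 0 ≤ m u := fun u => Nat.cast_nonneg _
  set S := (finite_zeros hf R₂).toFinset ∪ {0} with hS
  have hsub : ∀ (g : ℂ → ℝ) (R : ℝ), R ≤ R₂ →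
      Function.support (fun u => (if ‖u‖ ≤ R then m u else 0) * g u) ⊆ S := by
    intro g R hR u hu
    simp only [Function.mem_support, ne_eq, mul_eq_zero, not_or, ite_eq_right_iff,
      Classical.not_imp] at hu
    simp only [hS, Finset.coe_union, Set.Finite.coe_toFinset, Finset.coe_singleton]
    left
    simp only [Function.mem_support, ne_eq, ite_eq_right_iff, Classical.not_imp]
    exact ⟨hu.1.1.trans hR, hu.1.2⟩
  have hfs : ∀ (g : ℂ → ℝ) (R : ℝ), R ≤ R₂ →
      ∑ᶠ u, (if ‖u‖ ≤ R then m u else 0) * g u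
        = ∑ u ∈ S, (if ‖u‖ ≤ R then m u else 0) * g u :=
    fun g R hR => finsum_eq_sum_of_support_subset _ (hsub g R hR)
  have hz : ∀ R, R ≤ R₂ → (zeroCount f R : ℝ) * Real.log (R₂ / R₁)
      = ∑ u ∈ S, (if ‖u‖ ≤ R then m u else 0) * Real.log (R₂ / R₁) := by
    intro R hR
    rw [zeroCount_eq_finsum hf, ← Finset.sum_mul]
    congr 1
    have := hfs (fun _ => 1) R hR
    simpa using this
  have hzero : ∀ c : ℝ, m 0 * c = ∑ u ∈ S, if u = 0 then m 0 * c else 0 := by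
    intro c
    rw [Finset.sum_ite_eq' S 0]
    simp [hS]
  have hdiff : logMean f R₂ - logMean f R₁ = ∑ u ∈ S,
      ((if ‖u‖ ≤ R₂ then m u else 0) * Real.log (R₂ * ‖u‖⁻¹)
        - (if ‖u‖ ≤ R₁ then m u else 0) * Real.log (R₁ * ‖u‖⁻¹)
        + if u = 0 then m 0 * (Real.log R₂ - Real.log R₁) else 0) := by
    rw [logMean_eq hf h₁, logMean_eq hf h₂', Finset.sum_add_distrib, Finset.sum_sub_distrib,
      ← hfs _ R₂ le_rfl, ← hfs _ R₁ h₂.le, ← hzero]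
    ring
  have hlog : Real.log (R₂ / R₁) = Real.log R₂ - Real.log R₁ :=
    Real.log_div h₂'.ne' h₁.ne'
  have hL : Real.log R₁ < Real.log R₂ := Real.log_lt_log h₁ h₂
  -- the contribution of a zero `u` with `R₁ < |u| ≤ R₂` is `m u * log (R₂ / |u|)`
  have key : ∀ u, (if ‖u‖ ≤ R₁ then m u else 0) * Real.log (R₂ / R₁) ≤
      ((if ‖u‖ ≤ R₂ then m u else 0) * Real.log (R₂ * ‖u‖⁻¹)
        - (if ‖u‖ ≤ R₁ then m u else 0) * Real.log (R₁ * ‖u‖⁻¹)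
        + if u = 0 then m 0 * (Real.log R₂ - Real.log R₁) else 0) ∧
      ((if ‖u‖ ≤ R₂ then m u else 0) * Real.log (R₂ * ‖u‖⁻¹)
        - (if ‖u‖ ≤ R₁ then m u else 0) * Real.log (R₁ * ‖u‖⁻¹)
        + if u = 0 then m 0 * (Real.log R₂ - Real.log R₁) else 0) ≤
      (if ‖u‖ ≤ R₂ then m u else 0) * Real.log (R₂ / R₁) := by
    intro u
    rw [hlog]
    by_cases hu : u = 0
    · subst hu
      simp [h₁.le, h₂'.le]
    have hu' : 0 < ‖u‖ := norm_pos_iff.2 hu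
    rw [Real.log_mul h₂'.ne' (inv_ne_zero hu'.ne'), Real.log_mul h₁.ne' (inv_ne_zero hu'.ne'),
      Real.log_inv]
    by_cases hu1 : ‖u‖ ≤ R₁
    · simp only [hu1, hu1.trans h₂.le, hu, if_true, if_false]
      constructor <;> nlinarith
    · by_cases hu2 : ‖u‖ ≤ R₂
      · have e1 : Real.log R₁ ≤ Real.log ‖u‖ := Real.log_le_log h₁ (not_le.1 hu1).le
        have e2 : Real.log ‖u‖ ≤ Real.log R₂ := Real.log_le_log hu' hu2
        simp only [hu1, hu2, hu, if_true, if_false]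
        constructor <;> nlinarith [hm0 u]
      · simp [hu1, hu2, hu]
  rw [hz R₁ h₂.le, hz R₂ le_rfl, hdiff]
  exact ⟨Finset.sum_le_sum fun u _ => (key u).1, Finset.sum_le_sum fun u _ => (key u).2⟩

/-! ### Gaussian integrals -/

open scoped ENNReal in
/-- Tonelli's theorem for a product of functions of the single coordinates. -/
lemma lintegral_fin_prod {E : Type*} [MeasurableSpace E] {n : ℕ} (μ : Measure E) [SigmaFinite μ]
    (f : Fin n → E → ℝ≥0∞) (hf : ∀ i, Measurable (f i)) :
    ∫⁻ x, ∏ i, f i (x i) ∂(Measure.pi fun _ : Fin n => μ) = ∏ i, ∫⁻ x, f i x ∂μ := by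
  induction n with
  | zero => simp
  | succ n ih =>
    have h := (measurePreserving_piFinSuccAbove (fun _ : Fin (n + 1) => μ) 0).symm
    rw [← h.lintegral_comp_emb (MeasurableEquiv.measurableEmbedding _)]
    have e : ∀ a : E × (Fin n → E),
        ∏ i, f i ((MeasurableEquiv.piFinSuccAbove (fun _ : Fin (n + 1) => E) 0).symm a i)
          = f 0 a.1 * ∏ i : Fin n, f i.succ (a.2 i) := fun a => by
      rw [Fin.prod_univ_succ]; rfl
    simp_rw [e]
    rw [lintegral_prod_mul (f := f 0) (g := fun y : Fin n → E => ∏ i : Fin n, f i.succ (y i))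
      (hf 0).aemeasurable (Finset.measurable_prod _ fun i _ =>
        (hf i.succ).comp (measurable_pi_apply i)).aemeasurable,
      ih (fun i => f i.succ) fun i => hf _, Fin.prod_univ_succ]

open scoped ENNReal in
lemma pi_withDensity {E : Type*} [MeasurableSpace E] (n : ℕ) (μ : Measure E) [SigmaFinite μ]
    (f : E → ℝ≥0∞) (hf : Measurable f) [SigmaFinite (μ.withDensity f)] :
    (Measure.pi fun _ : Fin n => μ.withDensity f)
      = (Measure.pi fun _ : Fin n => μ).withDensity fun x => ∏ i, f (x i) := by
  refine (Measure.pi_eq fun s hs => ?_)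
  rw [withDensity_apply _ (MeasurableSet.univ_pi hs),
    ← lintegral_indicator (MeasurableSet.univ_pi hs)]
  have : (Set.univ.pi s).indicator (fun x : Fin n → E => ∏ i, f (x i))
      = fun x => ∏ i, (s i).indicator f (x i) := by
    classical
    ext x
    by_cases hx : x ∈ Set.univ.pi s
    · rw [Set.indicator_of_mem hx]
      exact Finset.prod_congr rfl fun i _ => (Set.indicator_of_mem (hx i (Set.mem_univ i)) f).symm
    · rw [Set.indicator_of_notMem hx]
      simp only [Set.mem_univ_pi, not_forall] at hx
      obtain ⟨i, hi⟩ := hx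
      exact (Finset.prod_eq_zero (Finset.mem_univ i) (Set.indicator_of_notMem hi f)).symm
  rw [this, lintegral_fin_prod μ _ fun i => hf.indicator (hs i)]
  exact Finset.prod_congr rfl fun i _ => by
    rw [withDensity_apply _ (hs i), lintegral_indicator (hs i)]

lemma lintegral_exp_neg_norm_sq_div {T : ℝ} (hT : 0 < T) :
    ∫⁻ y : ℂ, ENNReal.ofReal (Real.exp (-‖y‖ ^ 2 / T)) = ENNReal.ofReal (Real.pi * T) := by
  have h := GaussianFourier.integral_rexp_neg_mul_sq_norm (V := ℂ) (b := T⁻¹) (by positivity)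
  have h' : ∫ y : ℂ, Real.exp (-‖y‖ ^ 2 / T) = Real.pi * T := by
    have e : ∀ y : ℂ, -‖y‖ ^ 2 / T = -T⁻¹ * ‖y‖ ^ 2 := fun y => by ring
    simp only [e]
    rw [h]
    simp
  rw [← h', ofReal_integral_eq_lintegral_ofReal]
  · by_contra hn
    rw [integral_undef hn] at h'
    exact absurd h' (by positivity)
  · exact Filter.Eventually.of_forall fun y => (Real.exp_pos _).le

instance : IsProbabilityMeasure stdComplexGaussian := by
  constructor
  rw [stdComplexGaussian, withDensity_apply _ MeasurableSet.univ, Measure.restrict_univ]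
  simp_rw [ENNReal.ofReal_mul (inv_nonneg.2 Real.pi_pos.le)]
  rw [lintegral_const_mul _ (by fun_prop)]
  have := lintegral_exp_neg_norm_sq_div one_pos
  simp only [div_one, mul_one] at this
  rw [this, ← ENNReal.ofReal_mul (inv_nonneg.2 Real.pi_pos.le), inv_mul_cancel₀ Real.pi_ne_zero]
  simp

lemma lintegral_enorm_inv_ball (s : ℝ) (hs : 0 < s) :
    ∫⁻ y : ℂ, (Metric.closedBall (0 : ℂ) s).indicator (fun y => ‖y‖ₑ⁻¹) y
      ≤ ENNReal.ofReal (2 * Real.pi * s) := by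
  rw [← Complex.lintegral_comp_polarCoord_symm]
  have : ∀ p ∈ polarCoord.target, ENNReal.ofReal p.1 •
      (Metric.closedBall (0 : ℂ) s).indicator (fun y => ‖y‖ₑ⁻¹) (Complex.polarCoord.symm p)
      ≤ (Set.Ioc 0 s ×ˢ Set.Ioo (-Real.pi) Real.pi).indicator 1 p := by
    rintro ⟨ρ, θ⟩ hp
    simp only [polarCoord_target, Set.mem_prod, Set.mem_Ioi] at hp
    have hn : ‖Complex.polarCoord.symm (ρ, θ)‖ = ρ := by
      rw [Complex.norm_polarCoord_symm]; exact abs_of_pos hp.1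
    by_cases h : ρ ≤ s
    · have h1 : Complex.polarCoord.symm (ρ, θ) ∈ Metric.closedBall (0 : ℂ) s := by
        rw [mem_closedBall_zero_iff, hn]; exact h
      rw [Set.indicator_of_mem h1, Set.indicator_of_mem (by exact ⟨⟨hp.1, h⟩, hp.2⟩)]
      rw [← ofReal_norm, hn, smul_eq_mul, ENNReal.mul_inv_cancel]
      · rfl
      · simpa using hp.1
      · simp
    · have h1 : Complex.polarCoord.symm (ρ, θ) ∉ Metric.closedBall (0 : ℂ) s := by
        rw [mem_closedBall_zero_iff, hn]; exact h
      rw [Set.indicator_of_notMem h1]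
      simp
  have hm : MeasurableSet (Set.Ioc 0 s ×ˢ Set.Ioo (-Real.pi) Real.pi) :=
    measurableSet_Ioc.prod measurableSet_Ioo
  calc _ ≤ ∫⁻ p in polarCoord.target,
        (Set.Ioc 0 s ×ˢ Set.Ioo (-Real.pi) Real.pi).indicator 1 p :=
        setLIntegral_mono (measurable_one.indicator hm) this
    _ ≤ ∫⁻ p, (Set.Ioc 0 s ×ˢ Set.Ioo (-Real.pi) Real.pi).indicator 1 p :=
        setLIntegral_le_lintegral _ _
    _ = ENNReal.ofReal (2 * Real.pi * s) := by
        rw [lintegral_indicator_one hm, Measure.volume_eq_prod, Measure.prod_prod, Real.volume_Ioc,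
          Real.volume_Ioo, ← ENNReal.ofReal_mul (by linarith)]
        congr 1; ring

/-- The singularity of `1 / |y + b|` is integrable in the plane, with a bound uniform in `b`. -/
lemma lintegral_enorm_inv_mul_exp {T : ℝ} (hT : 0 < T) (b : ℂ) :
    ∫⁻ y : ℂ, ‖y + b‖ₑ⁻¹ * ENNReal.ofReal (Real.exp (-‖y‖ ^ 2 / T))
      ≤ ENNReal.ofReal (3 * Real.pi * Real.sqrt T) := by
  have hs : 0 < Real.sqrt T := Real.sqrt_pos.2 hT
  have hle : ∀ y : ℂ, ‖y + b‖ₑ⁻¹ * ENNReal.ofReal (Real.exp (-‖y‖ ^ 2 / T)) ≤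
      (Metric.closedBall (0 : ℂ) (Real.sqrt T)).indicator (fun y => ‖y‖ₑ⁻¹) (y + b)
      + ENNReal.ofReal (Real.sqrt T)⁻¹ * ENNReal.ofReal (Real.exp (-‖y‖ ^ 2 / T)) := by
    intro y
    by_cases h : ‖y + b‖ ≤ Real.sqrt T
    · rw [Set.indicator_of_mem (by simpa using h)]
      refine le_add_right (mul_le_of_le_one_right' ?_)
      rw [ENNReal.ofReal_le_one, Real.exp_le_one_iff]
      have : 0 ≤ ‖y‖ ^ 2 / T := by positivity
      rw [neg_div]; linarith
    · refine le_add_left ?_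
      gcongr
      rw [ENNReal.ofReal_inv_of_pos hs, ENNReal.inv_le_inv, ← ofReal_norm]
      exact ENNReal.ofReal_le_ofReal (not_le.1 h).le
  have hmeas : Measurable fun y : ℂ =>
      (Metric.closedBall (0 : ℂ) (Real.sqrt T)).indicator (fun y => ‖y‖ₑ⁻¹) (y + b) :=
    ((measurable_enorm.inv).indicator measurableSet_closedBall).comp (measurable_add_const b)
  calc _ ≤ ∫⁻ y : ℂ, _ := lintegral_mono hle
    _ = (∫⁻ y : ℂ, (Metric.closedBall (0 : ℂ) (Real.sqrt T)).indicator (fun y => ‖y‖ₑ⁻¹) y)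
        + ENNReal.ofReal (Real.sqrt T)⁻¹ * ENNReal.ofReal (Real.pi * T) := by
        rw [lintegral_add_left hmeas,
          lintegral_const_mul _ (by fun_prop), lintegral_exp_neg_norm_sq_div hT,
          lintegral_add_right_eq_self (fun y =>
            (Metric.closedBall (0 : ℂ) (Real.sqrt T)).indicator (fun y => ‖y‖ₑ⁻¹) y) b]
    _ ≤ ENNReal.ofReal (2 * Real.pi * Real.sqrt T)
        + ENNReal.ofReal (Real.sqrt T)⁻¹ * ENNReal.ofReal (Real.pi * T) := by
        gcongr; exact lintegral_enorm_inv_ball _ hs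
    _ = _ := by
        rw [← ENNReal.ofReal_mul (by positivity), ← ENNReal.ofReal_add (by positivity)
          (by positivity)]
        congr 1
        have h2 : (Real.sqrt T)⁻¹ * (Real.pi * T) = Real.pi * Real.sqrt T := by
          nth_rewrite 2 [← Real.mul_self_sqrt hT.le]
          field_simp
        rw [h2]; ring

/-! ### Products of inverse moduli of Gaussian linear forms -/

open scoped Matrix

lemma sum_norm_sq_mulVec {n : ℕ} (U : Matrix (Fin n) (Fin n) ℂ) (c : ℝ)
    (hU : Uᴴ * U = (c : ℂ) • (1 : Matrix (Fin n) (Fin n) ℂ)) (v : Fin n → ℂ) :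
    ∑ j, ‖(U *ᵥ v) j‖ ^ 2 = c * ∑ k, ‖v k‖ ^ 2 := by
  have h : ∀ w : Fin n → ℂ, ((∑ j, ‖w j‖ ^ 2 : ℝ) : ℂ) = star w ⬝ᵥ w := by
    intro w
    simp only [dotProduct, Pi.star_apply, RCLike.star_def, Complex.conj_mul']
    push_cast
    rfl
  have : ((∑ j, ‖(U *ᵥ v) j‖ ^ 2 : ℝ) : ℂ) = ((c * ∑ k, ‖v k‖ ^ 2 : ℝ) : ℂ) := by
    rw [h, Matrix.star_mulVec, ← Matrix.dotProduct_mulVec, Matrix.mulVec_mulVec, hU,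
      Matrix.smul_mulVec, Matrix.one_mulVec, dotProduct_smul, Complex.ofReal_mul, h, smul_eq_mul]
  exact_mod_cast this

lemma normSq_det {n : ℕ} (U : Matrix (Fin n) (Fin n) ℂ) (c : ℝ)
    (hU : Uᴴ * U = (c : ℂ) • (1 : Matrix (Fin n) (Fin n) ℂ)) :
    Complex.normSq U.det = c ^ n := by
  have h := congrArg Matrix.det hU
  rw [Matrix.det_mul, Matrix.det_conjTranspose, Matrix.det_smul, Matrix.det_one, mul_one,
    Fintype.card_fin, RCLike.star_def, ← Complex.normSq_eq_conj_mul_self] at h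
  exact_mod_cast h

/-- Change of variables under a complex linear map: the real Jacobian is `|det|²`. -/
lemma lintegral_comp_mulVec {n : ℕ} (A : Matrix (Fin n) (Fin n) ℂ) (hA : A.det ≠ 0)
    {F : (Fin n → ℂ) → ENNReal} (hF : Measurable F) :
    ∫⁻ w : Fin n → ℂ, F (A *ᵥ w) = ENNReal.ofReal (Complex.normSq A.det)⁻¹ * ∫⁻ y, F y := by
  set f : (Fin n → ℂ) →ₗ[ℝ] (Fin n → ℂ) := (Matrix.toLin' A).restrictScalars ℝ with hf
  have hdet : LinearMap.det f = Complex.normSq A.det := by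
    rw [hf, LinearMap.det_restrictScalars, LinearMap.det_toLin', Algebra.norm_complex_apply]
  have hne : LinearMap.det f ≠ 0 := by
    rw [hdet]; exact fun h => hA (Complex.normSq_eq_zero.1 h)
  have hm : Measurable f := (LinearMap.continuous_of_finiteDimensional f).measurable
  have h := Measure.map_linearMap_addHaar_eq_smul_addHaar (volume : Measure (Fin n → ℂ)) hne
  have h2 : ∫⁻ w : Fin n → ℂ, F (f w) = ∫⁻ y, F y ∂(Measure.map f volume) :=
    (lintegral_map hF hm).symm
  rw [h, lintegral_smul_measure, hdet, abs_of_nonneg (inv_nonneg.2 (Complex.normSq_nonneg _))] at h2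
  exact h2

/-- If `U` is `√n` times a unitary matrix and the weights `D k` lie
in `[d, τ]`, then the shifted linear forms `∑ k, U j k * D k * w k + b j` of a standard complex
Gaussian vector have `E ∏ |·|⁻¹` at most `(3 τ / d²) ^ n`, uniformly in the shift. -/
lemma lintegral_prod_inv_le {n : ℕ} (U : Matrix (Fin n) (Fin n) ℂ)
    (hU : Uᴴ * U = ((n : ℝ) : ℂ) • (1 : Matrix (Fin n) (Fin n) ℂ)) (D : Fin n → ℝ) {d τ : ℝ}
    (hd : 0 < d) (hdD : ∀ k, d ≤ D k) (hDτ : ∀ k, D k ≤ τ) (b : Fin n → ℂ) :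
    ∫⁻ w, ∏ j, ‖∑ k, U j k * ((D k : ℂ) * w k) + b j‖ₑ⁻¹
        ∂(Measure.pi fun _ : Fin n => stdComplexGaussian)
      ≤ ENNReal.ofReal ((3 * τ / d ^ 2) ^ n) := by
  rcases Nat.eq_zero_or_pos n with rfl | hn
  · simp
  have hτ : 0 < τ := (hd.trans_le (hdD ⟨0, hn⟩)).trans_le (hDτ ⟨0, hn⟩)
  have hn' : (0 : ℝ) < n := Nat.cast_pos.2 hn
  have hT : 0 < n * τ ^ 2 := by positivity
  set A : Matrix (Fin n) (Fin n) ℂ := U * Matrix.diagonal (fun k => (D k : ℂ)) with hA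
  have hAw : ∀ w, A *ᵥ w = U *ᵥ fun k => (D k : ℂ) * w k := by
    intro w
    rw [hA, ← Matrix.mulVec_mulVec]
    congr 1
    ext k
    exact Matrix.mulVec_diagonal _ _ k
  have hdetA : Complex.normSq A.det = n ^ n * ∏ k, D k ^ 2 := by
    rw [hA, Matrix.det_mul, map_mul, normSq_det U n hU, Matrix.det_diagonal, map_prod]
    simp [Complex.normSq_ofReal, sq]
  have hdet_ge : (n * d ^ 2) ^ n ≤ Complex.normSq A.det := by
    rw [hdetA, mul_pow]
    gcongr
    calc (d ^ 2) ^ n = ∏ k : Fin n, d ^ 2 := by simp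
      _ ≤ ∏ k, D k ^ 2 := Finset.prod_le_prod (fun _ _ => by positivity) fun k _ => by
          have := hdD k; gcongr
  have hdet0 : A.det ≠ 0 := by
    intro h
    rw [h, map_zero] at hdet_ge
    exact absurd hdet_ge (not_le.2 (by positivity))
  set F : (Fin n → ℂ) → ENNReal := fun y => ∏ j, (ENNReal.ofReal Real.pi⁻¹ *
    (‖y j + b j‖ₑ⁻¹ * ENNReal.ofReal (Real.exp (-‖y j‖ ^ 2 / (n * τ ^ 2))))) with hFdef
  have hF : Measurable F := by fun_prop
  have hρm : Measurable fun w : ℂ => ENNReal.ofReal (Real.pi⁻¹ * Real.exp (-‖w‖ ^ 2)) := by fun_prop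
  have hpi : (Measure.pi fun _ : Fin n => stdComplexGaussian) =
      (volume : Measure (Fin n → ℂ)).withDensity fun x =>
        ∏ i, ENNReal.ofReal (Real.pi⁻¹ * Real.exp (-‖x i‖ ^ 2)) := by
    have : SigmaFinite (volume.withDensity fun w : ℂ =>
        ENNReal.ofReal (Real.pi⁻¹ * Real.exp (-‖w‖ ^ 2))) :=
      inferInstanceAs (SigmaFinite stdComplexGaussian)
    exact pi_withDensity n volume _ hρm
  have hG : Measurable fun w : Fin n → ℂ => ∏ j, ‖∑ k, U j k * ((D k : ℂ) * w k) + b j‖ₑ⁻¹ := by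
    fun_prop
  rw [hpi, lintegral_withDensity_eq_lintegral_mul _ (by fun_prop) hG]
  -- the Gaussian density is dominated by a product density in the coordinates `A *ᵥ w`
  have hpt : ∀ w : Fin n → ℂ,
      ((fun x : Fin n → ℂ => ∏ i, ENNReal.ofReal (Real.pi⁻¹ * Real.exp (-‖x i‖ ^ 2))) *
      fun w : Fin n → ℂ => ∏ j, ‖∑ k, U j k * ((D k : ℂ) * w k) + b j‖ₑ⁻¹) w ≤ F (A *ᵥ w) := by
    intro w
    have hsum : ∑ j, -‖w j‖ ^ 2 ≤ ∑ j, -‖(A *ᵥ w) j‖ ^ 2 / (n * τ ^ 2) := by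
      rw [← Finset.sum_div]
      simp only [Finset.sum_neg_distrib]
      rw [hAw, sum_norm_sq_mulVec U n hU, neg_div, neg_le_neg_iff, div_le_iff₀ hT]
      have : ∑ k, ‖(D k : ℂ) * w k‖ ^ 2 ≤ τ ^ 2 * ∑ k, ‖w k‖ ^ 2 := by
        rw [Finset.mul_sum]
        refine Finset.sum_le_sum fun k _ => ?_
        have h0 : 0 ≤ D k := hd.le.trans (hdD k)
        rw [norm_mul, mul_pow, Complex.norm_real, Real.norm_of_nonneg h0]
        have := hDτ k
        gcongr
      nlinarith
    have e1 : ∏ i, ENNReal.ofReal (Real.pi⁻¹ * Real.exp (-‖w i‖ ^ 2))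
        ≤ ∏ i, (ENNReal.ofReal Real.pi⁻¹ *
          ENNReal.ofReal (Real.exp (-‖(A *ᵥ w) i‖ ^ 2 / (n * τ ^ 2)))) := by
      simp_rw [← ENNReal.ofReal_mul (inv_nonneg.2 Real.pi_pos.le)]
      rw [← ENNReal.ofReal_prod_of_nonneg fun i _ => by positivity,
        ← ENNReal.ofReal_prod_of_nonneg fun i _ => by positivity]
      refine ENNReal.ofReal_le_ofReal ?_
      rw [Finset.prod_mul_distrib, Finset.prod_mul_distrib, ← Real.exp_sum, ← Real.exp_sum]
      gcongr
    have e2 : ∀ j, ∑ k, U j k * ((D k : ℂ) * w k) = (A *ᵥ w) j := by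
      intro j; rw [hAw]; rfl
    simp only [Pi.mul_apply, e2, hFdef]
    refine (mul_le_mul_left e1 _).trans (le_of_eq ?_)
    rw [← Finset.prod_mul_distrib]
    exact Finset.prod_congr rfl fun j _ => by ring
  refine (lintegral_mono hpt).trans ?_
  rw [lintegral_comp_mulVec A hdet0 hF]
  have hFint : ∫⁻ y, F y ≤ ENNReal.ofReal ((3 * Real.sqrt (n * τ ^ 2)) ^ n) := by
    have := lintegral_fin_prod (n := n) (volume : Measure ℂ) (fun j y => ENNReal.ofReal Real.pi⁻¹ *
      (‖y + b j‖ₑ⁻¹ * ENNReal.ofReal (Real.exp (-‖y‖ ^ 2 / (n * τ ^ 2))))) (fun j => by fun_prop)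
    refine (le_of_eq this).trans ?_
    rw [ENNReal.ofReal_pow (by positivity)]
    refine (Finset.prod_le_prod' (g := fun _ => ENNReal.ofReal (3 * Real.sqrt (n * τ ^ 2)))
      fun j _ => ?_).trans (by simp)
    rw [lintegral_const_mul _ (by fun_prop)]
    refine (mul_le_mul_right (lintegral_enorm_inv_mul_exp hT (b j)) _).trans ?_
    rw [← ENNReal.ofReal_mul (by positivity)]
    refine ENNReal.ofReal_le_ofReal (le_of_eq ?_)
    field_simp
  refine (mul_le_mul_right hFint _).trans ?_
  rw [← ENNReal.ofReal_mul (inv_nonneg.2 (Complex.normSq_nonneg _))]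
  refine ENNReal.ofReal_le_ofReal ?_
  have h1 : (Complex.normSq A.det)⁻¹ ≤ ((n * d ^ 2) ^ n)⁻¹ := by gcongr
  calc _ ≤ ((n * d ^ 2) ^ n)⁻¹ * (3 * Real.sqrt (n * τ ^ 2)) ^ n := by gcongr
    _ = (3 * Real.sqrt (n * τ ^ 2) / (n * d ^ 2)) ^ n := by rw [div_pow]; ring
    _ ≤ _ := by
      have hs : Real.sqrt (n * τ ^ 2) ≤ n * τ := by
        rw [Real.sqrt_le_left (by positivity)]
        have : (1 : ℝ) ≤ n := by exact_mod_cast hn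
        nlinarith [sq_nonneg τ, mul_le_mul_of_nonneg_right this (by positivity : 0 ≤ n * τ ^ 2)]
      refine pow_le_pow_left₀ (by positivity) ?_ n
      rw [div_le_div_iff₀ (by positivity) (by positivity)]
      have := mul_le_mul_of_nonneg_left hs (by positivity : 0 ≤ 3 * d ^ 2)
      linarith

/-! ### The Gaussian coefficient sequence -/

/-- The law of a sequence of independent standard complex Gaussian variables. -/
noncomputable def gaussianSeq : Measure (ℕ → ℂ) :=
  Measure.infinitePi fun _ => stdComplexGaussian

instance : IsProbabilityMeasure gaussianSeq := by unfold gaussianSeq; infer_instance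

lemma lintegral_eval_gaussianSeq {f : ℂ → ENNReal} (hf : Measurable f) (k : ℕ) :
    ∫⁻ a, f (a k) ∂gaussianSeq = ∫⁻ w, f w ∂stdComplexGaussian :=
  (measurePreserving_eval_infinitePi (fun _ : ℕ => stdComplexGaussian) k).lintegral_comp hf

lemma iIndepFun_gaussianSeq : iIndepFun (fun (k : ℕ) (a : ℕ → ℂ) => a k) gaussianSeq :=
  iIndepFun_infinitePi (X := fun _ ω => ω) (by fun_prop)

/-- Conditioning: a bound for the integral over the coefficients in a block `e`, uniform in the
coefficients with indices in `T`, is a bound for the expectation. -/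
lemma lintegral_block_le {n : ℕ} {e : Fin n → ℕ} (he : Function.Injective e) (T : Finset ℕ)
    (hT : ∀ i, e i ∉ T) {F : (Fin n → ℂ) × (T → ℂ) → ENNReal} (hF : Measurable F) {C : ENNReal}
    (hC : ∀ y, ∫⁻ x, F (x, y) ∂(Measure.pi fun _ : Fin n => stdComplexGaussian) ≤ C) :
    ∫⁻ a, F (fun i => a (e i), fun k : T => a k) ∂gaussianSeq ≤ C := by
  classical
  have hX : Measurable fun (a : ℕ → ℂ) (i : Fin n) => a (e i) := by fun_prop
  have hY : Measurable fun (a : ℕ → ℂ) (k : T) => a k := by fun_prop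
  have hdisj : Disjoint (Finset.univ.image e) T := by
    rw [Finset.disjoint_left]
    intro k hk
    obtain ⟨i, -, rfl⟩ := Finset.mem_image.1 hk
    exact hT i
  have hind0 := iIndepFun_gaussianSeq.indepFun_finset (Finset.univ.image e) T hdisj
    fun k => measurable_pi_apply k
  have hind : IndepFun (fun (a : ℕ → ℂ) (i : Fin n) => a (e i)) (fun (a : ℕ → ℂ) (k : T) => a k)
      gaussianSeq :=
    hind0.comp (φ := fun (x : ↥(Finset.univ.image e) → ℂ) (i : Fin n) =>
      x ⟨e i, Finset.mem_image_of_mem e (Finset.mem_univ i)⟩) (ψ := id) (by fun_prop) measurable_id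
  have hlaw : gaussianSeq.map (fun (a : ℕ → ℂ) (i : Fin n) => a (e i))
      = Measure.pi fun _ : Fin n => stdComplexGaussian := by
    rw [gaussianSeq,
      Measure.map_infinitePi_infinitePi_of_inj (P := fun _ : ℕ => stdComplexGaussian) he, Measure.infinitePi_eq_pi]
  have hprod := (indepFun_iff_map_prod_eq_prod_map_map hX.aemeasurable hY.aemeasurable).1 hind
  have : IsProbabilityMeasure (gaussianSeq.map (fun (a : ℕ → ℂ) (k : T) => a k)) :=
    Measure.isProbabilityMeasure_map hY.aemeasurable
  rw [← lintegral_map (μ := gaussianSeq) (f := F)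
    (g := fun a => (fun i => a (e i), fun k : T => a k)) hF (by fun_prop), hprod, hlaw,
    lintegral_prod_symm _ hF.aemeasurable]
  refine (lintegral_mono hC).trans ?_
  simp

/-! ### Roots of unity -/

/-- The matrix whose rows are given by `n` equispaced points of the unit circle and whose columns by
`n` consecutive powers is `√n` times a unitary matrix. -/
lemma conjTranspose_mul_self_roots {n : ℕ} (hn : 0 < n) (k₀ : ℕ) (θ : ℝ)
    (U : Matrix (Fin n) (Fin n) ℂ)
    (hU : ∀ j k, U j k = circleMap 0 1 (θ + 2 * Real.pi * j / n) ^ (k₀ + k : ℕ)) :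
    Uᴴ * U = ((n : ℝ) : ℂ) • (1 : Matrix (Fin n) (Fin n) ℂ) := by
  set ω : ℂ := Complex.exp (2 * Real.pi * Complex.I / n) with hω
  have hprim : IsPrimitiveRoot ω n := Complex.isPrimitiveRoot_exp n hn.ne'
  set u : ℂ := circleMap 0 1 θ with hu
  have hpt : ∀ j : Fin n, circleMap 0 1 (θ + 2 * Real.pi * j / n) = u * ω ^ (j : ℕ) := by
    intro j
    simp only [hu, hω, circleMap, zero_add, Complex.ofReal_one, one_mul, ← Complex.exp_nat_mul,
      ← Complex.exp_add]
    congr 1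
    push_cast
    ring
  have hωn : starRingEnd ℂ ω * ω = 1 := by
    rw [Complex.conj_mul', hprim.norm'_eq_one hn.ne']; simp
  have hun : starRingEnd ℂ u * u = 1 := by
    rw [Complex.conj_mul', hu, norm_circleMap_zero]; simp
  ext k l
  rw [Matrix.mul_apply]
  simp only [Matrix.conjTranspose_apply, hU, hpt, RCLike.star_def, map_pow, map_mul,
    Matrix.smul_apply, Matrix.one_apply, smul_eq_mul]
  set v := starRingEnd ℂ u with hv
  set η := starRingEnd ℂ ω with hη
  set ρ : ℂ := η ^ (k₀ + k : ℕ) * ω ^ (k₀ + l : ℕ) with hρ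
  have hterm : ∀ j : Fin n, (v * η ^ (j : ℕ)) ^ (k₀ + k : ℕ) * (u * ω ^ (j : ℕ)) ^ (k₀ + l : ℕ)
      = (v ^ (k₀ + k : ℕ) * u ^ (k₀ + l : ℕ)) * ρ ^ (j : ℕ) := by
    intro j
    rw [hρ]
    simp only [mul_pow, ← pow_mul]
    ring
  simp_rw [hterm]
  rw [← Finset.mul_sum, Fin.sum_univ_eq_sum_range (fun j => ρ ^ j) n]
  by_cases hkl : k = l
  · subst hkl
    have h1 : ρ = 1 := by rw [hρ, ← mul_pow, hωn, one_pow]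
    rw [h1, ← mul_pow, hun]
    simp
  · have hρ1 : ρ ≠ 1 := by
      intro h
      apply hkl
      have h2 : ω ^ (k₀ + k : ℕ) = ω ^ (k₀ + l : ℕ) := by
        calc ω ^ (k₀ + k : ℕ) = ω ^ (k₀ + k : ℕ) * ρ := by rw [h, mul_one]
          _ = (η * ω) ^ (k₀ + k : ℕ) * ω ^ (k₀ + l : ℕ) := by rw [hρ, mul_pow]; ring
          _ = ω ^ (k₀ + l : ℕ) := by rw [hωn, one_pow, one_mul]
      rw [pow_add, pow_add] at h2
      have h3 := mul_left_cancel₀ (pow_ne_zero _ (hprim.ne_zero hn.ne')) h2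
      exact Fin.ext (hprim.pow_inj k.2 l.2 h3)
    have hρn : ρ ^ n = 1 := by
      have hηn : η ^ n = 1 := by rw [hη, ← map_pow, hprim.pow_eq_one, map_one]
      rw [hρ, mul_pow, ← pow_mul, ← pow_mul, mul_comm _ n, mul_comm _ n, pow_mul, pow_mul,
        hηn, hprim.pow_eq_one]
      simp
    have hg : ∑ j ∈ Finset.range n, ρ ^ j = 0 := by
      have := mul_neg_geom_sum ρ n
      rw [hρn, sub_self] at this
      exact (mul_eq_zero.1 this).resolve_left (sub_ne_zero.2 hρ1.symm)
    rw [hg]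
    simp [hkl]

/-! ### Inverse moments at equispaced points -/

/-- The partial sums of `gaussianSeries`. -/
noncomputable def gaussianPartialSum (N : ℕ) (a : ℕ → ℂ) (z : ℂ) : ℂ :=
  ∑ k ∈ Finset.range N, a k * (z ^ k / (Real.sqrt (Nat.factorial k : ℝ) : ℂ))

lemma measurable_gaussianPartialSum (N : ℕ) :
    Measurable fun p : (ℕ → ℂ) × ℂ => gaussianPartialSum N p.1 p.2 := by
  unfold gaussianPartialSum
  fun_prop

lemma RapidDecay.tendsto_gaussianPartialSum {a : ℕ → ℂ} (ha : RapidDecay a) (z : ℂ) :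
    Filter.Tendsto (fun N => gaussianPartialSum N a z) Filter.atTop (nhds (gaussianSeries a z)) :=
  (ha.summable z).hasSum.tendsto_sum_nat

/-- The inverse moment of the partial sums at `n` equispaced points of the circle `|z| = r`, bounded
through a lower bound `d` for the weights of one block of `n` consecutive coefficients. -/
lemma lintegral_prod_inv_partialSum_le {n k₀ N : ℕ} (hn : 0 < n) (hN : k₀ + n ≤ N) {r d : ℝ}
    (hr : 0 < r) (hd : 0 < d)
    (hdk : ∀ k, k₀ ≤ k → k < k₀ + n → d ≤ r ^ k / Real.sqrt (Nat.factorial k : ℝ)) (θ : ℝ) :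
    ∫⁻ a, ∏ j : Fin n, ‖gaussianPartialSum N a (circleMap 0 r (θ + 2 * Real.pi * j / n))‖ₑ⁻¹
        ∂gaussianSeq
      ≤ ENNReal.ofReal ((3 * Real.exp (r ^ 2 / 2) / d ^ 2) ^ n) := by
  classical
  set z : Fin n → ℂ := fun j => circleMap 0 r (θ + 2 * Real.pi * j / n) with hz
  set T : Finset ℕ := Finset.range N \ Finset.Ico k₀ (k₀ + n) with hT
  set e : Fin n → ℕ := fun i => k₀ + i with he
  have hinj : Function.Injective e := fun i j h => Fin.ext (by simpa [he] using h)
  have heT : ∀ i, e i ∉ T := by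
    intro i
    have := i.2
    simp only [hT, he, Finset.mem_sdiff, Finset.mem_Ico]
    omega
  set U : Matrix (Fin n) (Fin n) ℂ :=
    fun j k => circleMap 0 1 (θ + 2 * Real.pi * j / n) ^ (k₀ + k : ℕ) with hU
  set D : Fin n → ℝ := fun k => r ^ (k₀ + k : ℕ) / Real.sqrt (Nat.factorial (k₀ + k) : ℝ) with hD
  set c : Fin n → ℕ → ℂ := fun j k => z j ^ k / (Real.sqrt (Nat.factorial k : ℝ) : ℂ) with hc
  have hcU : ∀ j k : Fin n, c j (k₀ + k : ℕ) = U j k * D k := by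
    intro j k
    have : z j = r * circleMap 0 1 (θ + 2 * Real.pi * j / n) := by simp [hz, circleMap]
    simp only [hc, hU, hD, this, mul_pow]
    push_cast
    ring
  have hsplit : ∀ a j, gaussianPartialSum N a (z j) =
      ∑ k : Fin n, U j k * ((D k : ℂ) * a (e k)) + ∑ k : T, a k * c j k := by
    intro a j
    have hsub : Finset.Ico k₀ (k₀ + n) ⊆ Finset.range N := fun k hk => by
      simp only [Finset.mem_Ico, Finset.mem_range] at *; omega
    rw [gaussianPartialSum, ← Finset.sum_sdiff hsub, add_comm]
    congr 1
    · rw [Finset.sum_Ico_eq_sum_range, Nat.add_sub_cancel_left,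
        ← Fin.sum_univ_eq_sum_range (fun i => a (k₀ + i) * (z j ^ (k₀ + i) /
          (Real.sqrt (Nat.factorial (k₀ + i) : ℝ) : ℂ))) n]
      refine Finset.sum_congr rfl fun k _ => ?_
      have := hcU j k
      simp only [hc] at this
      rw [this]
      ring
    · exact (Finset.sum_coe_sort T fun k => a k * c j k).symm
  change ∫⁻ a, ∏ j : Fin n, ‖gaussianPartialSum N a (z j)‖ₑ⁻¹ ∂gaussianSeq ≤ _
  simp_rw [hsplit]
  have hUU : Uᴴ * U = ((n : ℝ) : ℂ) • (1 : Matrix (Fin n) (Fin n) ℂ) :=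
    conjTranspose_mul_self_roots hn k₀ θ U fun j k => by simp only [hU]
  have hdD : ∀ k, d ≤ D k := fun k =>
    hdk _ (Nat.le_add_right _ _) (by have := k.2; omega)
  have hDτ : ∀ k, D k ≤ Real.exp (r ^ 2 / 2) := by
    intro k
    -- the square of the weight is a single term of the exponential series of `r ^ 2`
    have h1 := Real.pow_div_factorial_le_exp (r ^ 2) (by positivity) (k₀ + k)
    refine (abs_le_of_sq_le_sq' ?_ (Real.exp_pos _).le).2
    change (r ^ (k₀ + k : ℕ) / Real.sqrt (Nat.factorial (k₀ + k) : ℝ)) ^ 2 ≤ _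
    rw [div_pow, Real.sq_sqrt (by positivity), ← Real.exp_nat_mul, ← pow_mul, mul_comm _ 2, pow_mul,
      show ((2 : ℕ) : ℝ) * (r ^ 2 / 2) = r ^ 2 by push_cast; ring]
    exact h1
  set F : (Fin n → ℂ) × (T → ℂ) → ENNReal := fun p =>
    ∏ j, ‖∑ k : Fin n, U j k * ((D k : ℂ) * p.1 k) + ∑ k : T, p.2 k * c j k‖ₑ⁻¹ with hFdef
  have hF : Measurable F := by
    rw [hFdef]
    fun_prop
  exact lintegral_block_le hinj T heT hF fun y =>
    lintegral_prod_inv_le U hUU D hd hdD hDτ fun j => ∑ k : T, y k * c j k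

/-! ### Exponential moments and almost sure convergence -/

/-- Jensen's inequality for `exp`, without assuming that `exp ∘ g` is integrable. -/
lemma ofReal_exp_integral_le {α : Type*} [MeasurableSpace α] {ν : Measure α}
    [IsProbabilityMeasure ν] {g : α → ℝ} (hg : Integrable g ν) :
    ENNReal.ofReal (Real.exp (∫ x, g x ∂ν)) ≤ ∫⁻ x, ENNReal.ofReal (Real.exp (g x)) ∂ν := by
  set m := ∫ x, g x ∂ν with hm
  have hint : Integrable (fun x => Real.exp m * (1 + (g x - m))) ν :=
    ((integrable_const _).add (hg.sub (integrable_const _))).const_mul _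
  have hval : ∫ x, Real.exp m * (1 + (g x - m)) ∂ν = Real.exp m := by
    rw [integral_const_mul, integral_add (f := fun _ => (1 : ℝ)) (g := fun x => g x - m)
      (integrable_const _) (hg.sub (integrable_const _)), integral_sub hg (integrable_const _)]
    simp [← hm]
  calc ENNReal.ofReal (Real.exp m)
      ≤ ∫⁻ x, ENNReal.ofReal (Real.exp m * (1 + (g x - m))) ∂ν := by
        have hpos := integral_eq_lintegral_pos_part_sub_lintegral_neg_part hint
        rw [hval] at hpos
        conv_lhs => rw [hpos]
        refine (ENNReal.ofReal_le_ofReal (sub_le_self _ ENNReal.toReal_nonneg)).trans ?_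
        exact ENNReal.ofReal_toReal_le
    _ ≤ _ := by
        refine lintegral_mono fun x => ENNReal.ofReal_le_ofReal ?_
        -- the tangent line of `exp` at `m`
        have h := Real.add_one_le_exp (g x - m)
        calc _ ≤ Real.exp m * Real.exp (g x - m) := by gcongr; linarith
          _ = Real.exp (g x) := by rw [← Real.exp_add]; ring_nf

/-- `E exp |ζ|` for a standard complex Gaussian variable `ζ`. -/
noncomputable def expNormMean : ENNReal :=
  ∫⁻ w, ENNReal.ofReal (Real.exp ‖w‖) ∂stdComplexGaussian

lemma expNormMean_lt_top : expNormMean < ⊤ := by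
  have hle : expNormMean
      ≤ ENNReal.ofReal (Real.pi⁻¹ * Real.exp 1) * ENNReal.ofReal (Real.pi * 2) := by
    rw [expNormMean, stdComplexGaussian, lintegral_withDensity_eq_lintegral_mul _ (by fun_prop)
      (by fun_prop), ← lintegral_exp_neg_norm_sq_div two_pos, ← lintegral_const_mul _ (by fun_prop)]
    refine lintegral_mono fun w => ?_
    simp only [Pi.mul_apply]
    rw [← ENNReal.ofReal_mul (by positivity), ← ENNReal.ofReal_mul (by positivity), mul_assoc,
      mul_assoc, ← Real.exp_add, ← Real.exp_add]
    refine ENNReal.ofReal_le_ofReal ?_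
    refine mul_le_mul_of_nonneg_left (Real.exp_le_exp.2 ?_) (by positivity)
    nlinarith [sq_nonneg (‖w‖ - 1)]
  exact hle.trans_lt (ENNReal.mul_lt_top ENNReal.ofReal_lt_top ENNReal.ofReal_lt_top)

lemma lintegral_enorm_le : ∫⁻ w, ‖w‖ₑ ∂stdComplexGaussian ≤ expNormMean := by
  refine lintegral_mono fun w => ?_
  rw [← ofReal_norm]
  exact ENNReal.ofReal_le_ofReal (by linarith [Real.add_one_le_exp ‖w‖])

/-- The weights `R ^ k / √(k!)` of the coefficients on the circle `|z| = R`. -/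
noncomputable def radialWeight (R : ℝ) (k : ℕ) : ℝ := R ^ k / Real.sqrt (Nat.factorial k : ℝ)

lemma radialWeight_nonneg {R : ℝ} (hR : 0 ≤ R) (k : ℕ) : 0 ≤ radialWeight R k := by
  unfold radialWeight; positivity

lemma radialWeight_pos {R : ℝ} (hR : 0 < R) (k : ℕ) : 0 < radialWeight R k := by
  unfold radialWeight; positivity

/-- Cauchy-Schwarz in the form `2 x y ≤ s x² + s⁻¹ y²`, comparing with the exponential series of
`q² R²` and a geometric series; `s` is chosen in `tsum_radialWeight_le`. -/
lemma radialWeight_le (R : ℝ) {q s : ℝ} (hq : 0 < q) (hs : 0 < s) (k : ℕ) :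
    radialWeight R k ≤ s * ((q ^ 2 * R ^ 2) ^ k / Nat.factorial k) + s⁻¹ * ((q⁻¹) ^ 2) ^ k := by
  set x := (q * R) ^ k / Real.sqrt (Nat.factorial k : ℝ) with hx
  set y := (q⁻¹) ^ k with hy
  have hxy : radialWeight R k = x * y := by
    rw [radialWeight, hx, hy, mul_pow, inv_pow]
    field_simp
  have hx2 : (q ^ 2 * R ^ 2) ^ k / Nat.factorial k = x ^ 2 := by
    rw [hx, div_pow, Real.sq_sqrt (by positivity)]
    ring
  have hy2 : ((q⁻¹) ^ 2) ^ k = y ^ 2 := by rw [hy]; ring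
  have hss : s * s⁻¹ = 1 := mul_inv_cancel₀ hs.ne'
  rw [hxy, hx2, hy2]
  have h := mul_nonneg hs.le (sq_nonneg (x - s⁻¹ * y))
  have hs' : 0 < s⁻¹ := inv_pos.2 hs
  have e : s * (x - s⁻¹ * y) ^ 2 = s * x ^ 2 + s⁻¹ * y ^ 2 - 2 * (x * y) := by
    linear_combination (-2 * x * y + s⁻¹ * y ^ 2) * hss
  have h3 : 0 ≤ s * x ^ 2 := by positivity
  have h4 : 0 ≤ s⁻¹ * y ^ 2 := by positivity
  linarith

lemma hasSum_radialWeight_majorant (R : ℝ) {q s : ℝ} (hq : 1 < q) :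
    HasSum (fun k : ℕ => s * ((q ^ 2 * R ^ 2) ^ k / Nat.factorial k) + s⁻¹ * ((q⁻¹) ^ 2) ^ k)
      (s * Real.exp (q ^ 2 * R ^ 2) + s⁻¹ * (1 - (q⁻¹) ^ 2)⁻¹) := by
  have h1 : HasSum (fun k : ℕ => (q ^ 2 * R ^ 2) ^ k / Nat.factorial k)
      (Real.exp (q ^ 2 * R ^ 2)) := by
    rw [Real.exp_eq_exp_ℝ]
    exact NormedSpace.expSeries_div_hasSum_exp (𝔸 := ℝ) _
  have h2 : HasSum (fun k : ℕ => ((q⁻¹) ^ 2) ^ k) (1 - (q⁻¹) ^ 2)⁻¹ := by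
    refine hasSum_geometric_of_lt_one (by positivity) ?_
    have : q⁻¹ < 1 := inv_lt_one_of_one_lt₀ hq
    exact pow_lt_one₀ (by positivity) this two_ne_zero
  exact (h1.mul_left s).add (h2.mul_left s⁻¹)

lemma summable_radialWeight {R : ℝ} (hR : 0 ≤ R) : Summable (radialWeight R) :=
  Summable.of_nonneg_of_le (radialWeight_nonneg hR)
    (radialWeight_le R (q := 2) (s := 1) (by norm_num) one_pos)
    (hasSum_radialWeight_majorant R (by norm_num)).summable

lemma tsum_radialWeight_le {R q : ℝ} (hR : 0 ≤ R) (hq : 1 < q) :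
    ∑' k, radialWeight R k ≤ (1 + (1 - (q⁻¹) ^ 2)⁻¹) * Real.exp (q ^ 2 * R ^ 2 / 2) := by
  set s := Real.exp (-(q ^ 2 * R ^ 2 / 2)) with hs
  have h := hasSum_radialWeight_majorant R (s := s) hq
  have h1 : ∑' k, radialWeight R k ≤ _ := (summable_radialWeight hR).tsum_le_tsum
    (radialWeight_le R (by linarith) (Real.exp_pos _)) h.summable
  rw [h.tsum_eq] at h1
  have e1 : s * Real.exp (q ^ 2 * R ^ 2) = Real.exp (q ^ 2 * R ^ 2 / 2) := by
    rw [hs, ← Real.exp_add]; ring_nf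
  have e2 : s⁻¹ = Real.exp (q ^ 2 * R ^ 2 / 2) := by rw [hs, ← Real.exp_neg, neg_neg]
  rw [e1, e2] at h1
  linarith

lemma ae_rapidDecay : ∀ᵐ a ∂gaussianSeq, RapidDecay a := by
  have key : ∀ M : ℕ, ∀ᵐ a ∂gaussianSeq, Summable fun k => ‖a k‖ * radialWeight M k := by
    intro M
    have hM : (0 : ℝ) ≤ M := Nat.cast_nonneg M
    have hmeas : ∀ k, Measurable fun a : ℕ → ℂ => ENNReal.ofReal (radialWeight M k) * ‖a k‖ₑ :=
      fun k => (measurable_pi_apply k).enorm.const_mul _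
    have hfin : ∫⁻ a, ∑' k, ENNReal.ofReal (radialWeight M k) * ‖a k‖ₑ ∂gaussianSeq ≠ ⊤ := by
      rw [lintegral_tsum fun k => (hmeas k).aemeasurable]
      have : ∀ k, ∫⁻ a, ENNReal.ofReal (radialWeight M k) * ‖a k‖ₑ ∂gaussianSeq
          ≤ ENNReal.ofReal (radialWeight M k) * expNormMean := fun k => by
        rw [lintegral_const_mul _ (by fun_prop), lintegral_eval_gaussianSeq measurable_enorm]
        gcongr
        exact lintegral_enorm_le
      refine ((ENNReal.tsum_le_tsum this).trans_lt ?_).ne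
      rw [ENNReal.tsum_mul_right, ← ENNReal.ofReal_tsum_of_nonneg (radialWeight_nonneg hM)
        (summable_radialWeight hM)]
      exact ENNReal.mul_lt_top ENNReal.ofReal_lt_top expNormMean_lt_top
    filter_upwards [ae_lt_top (Measurable.tsum hmeas) hfin] with a ha
    have h := ENNReal.summable_toReal ha.ne
    refine h.congr fun k => ?_
    rw [ENNReal.toReal_mul, ENNReal.toReal_ofReal (radialWeight_nonneg hM k), toReal_enorm, mul_comm]
  filter_upwards [ae_all_iff.2 key] with a ha R hR
  obtain ⟨M, hM⟩ := exists_nat_ge R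
  refine Summable.of_nonneg_of_le (fun k => by positivity) (fun k => ?_) (ha M)
  unfold radialWeight
  gcongr

/-! ### Tails of the logarithmic mean -/

lemma circleIntegrable_log_norm_of_differentiable {f : ℂ → ℂ} (hf : Differentiable ℂ f) (r : ℝ) :
    CircleIntegrable (fun z => Real.log ‖f z‖) 0 r :=
  MeromorphicOn.circleIntegrable_log_norm fun z _ => (hf.analyticAt z).meromorphicAt

/-- Jensen's inequality for the uniform measure on the circle, applied to the average of `log ‖f‖`
over `n` equispaced points. -/
lemma ofReal_exp_neg_logMean_le {f : ℂ → ℂ} (hf : Differentiable ℂ f) (r : ℝ) (n : ℕ) :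
    ENNReal.ofReal (Real.exp (-(n * logMean f r))) ≤ ENNReal.ofReal (2 * Real.pi)⁻¹ *
      ∫⁻ θ in Set.Ioc 0 (2 * Real.pi),
        ∏ j : Fin n, ‖f (circleMap 0 r (θ + 2 * Real.pi * j / n))‖ₑ⁻¹ := by
  have hpi : 0 < 2 * Real.pi := by positivity
  set ν : Measure ℝ :=
    ENNReal.ofReal (2 * Real.pi)⁻¹ • volume.restrict (Set.Ioc 0 (2 * Real.pi)) with hν
  have : IsProbabilityMeasure ν := by
    constructor
    rw [hν, Measure.smul_apply, Measure.restrict_apply_univ, Real.volume_Ioc, smul_eq_mul,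
      ← ENNReal.ofReal_mul (inv_nonneg.2 hpi.le), sub_zero, inv_mul_cancel₀ hpi.ne']
    simp
  have hper : Function.Periodic (fun θ => Real.log ‖f (circleMap 0 r θ)‖) (2 * Real.pi) :=
    fun θ => by simp [periodic_circleMap 0 r θ]
  have hint : ∀ s : ℝ, Integrable (fun θ => Real.log ‖f (circleMap 0 r (θ + s))‖)
      (volume.restrict (Set.Ioc 0 (2 * Real.pi))) := by
    intro s
    have h0 : IntervalIntegrable (fun θ => Real.log ‖f (circleMap 0 r θ)‖) volume 0 (2 * Real.pi) :=
      circleIntegrable_log_norm_of_differentiable hf r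
    have h1 := hper.intervalIntegrable (t := 0) hpi.ne' (by rwa [zero_add]) s (2 * Real.pi + s)
    have h2 := h1.comp_add_right s
    rw [sub_self, add_sub_cancel_right] at h2
    exact (intervalIntegrable_iff_integrableOn_Ioc_of_le hpi.le).1 h2
  have hval : ∀ s : ℝ, ∫ θ, Real.log ‖f (circleMap 0 r (θ + s))‖ ∂ν = logMean f r := by
    intro s
    rw [hν, integral_smul_measure, ENNReal.toReal_ofReal (inv_nonneg.2 hpi.le),
      ← intervalIntegral.integral_of_le hpi.le, logMean, Real.circleAverage_eq_integral_add s]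
  have hgint : Integrable
      (fun θ => -∑ j : Fin n, Real.log ‖f (circleMap 0 r (θ + 2 * Real.pi * j / n))‖) ν :=
    ((integrable_finsetSum _ fun j _ => hint _).neg).smul_measure ENNReal.ofReal_ne_top
  have hg : ∫ θ, -∑ j : Fin n, Real.log ‖f (circleMap 0 r (θ + 2 * Real.pi * j / n))‖ ∂ν
      = -(n * logMean f r) := by
    rw [integral_neg, integral_finsetSum _ fun j _ => (hint _).smul_measure ENNReal.ofReal_ne_top]
    have hj : ∀ j : Fin n, ∫ θ, Real.log ‖f (circleMap 0 r (θ + 2 * Real.pi * j / n))‖ ∂ν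
        = logMean f r := fun j => hval _
    rw [Finset.sum_congr rfl fun j _ => hj j]
    simp
  rw [← hg]
  refine (ofReal_exp_integral_le hgint).trans ?_
  rw [hν, lintegral_smul_measure, smul_eq_mul]
  gcongr with θ
  rw [← Finset.sum_neg_distrib, Real.exp_sum, ENNReal.ofReal_prod_of_nonneg fun j _ =>
    (Real.exp_pos _).le]
  refine Finset.prod_le_prod' fun j _ => ?_
  set x := f (circleMap 0 r (θ + 2 * Real.pi * j / n)) with hx
  -- at a zero the right-hand side is `⊤`
  by_cases h : x = 0
  · simp [h]
  · have hpos : 0 < ‖x‖ := norm_pos_iff.2 h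
    rw [Real.exp_neg, Real.exp_log hpos, ENNReal.ofReal_inv_of_pos hpos, ofReal_norm]

lemma prod_enorm_inv {ι : Type*} (s : Finset ι) (x : ι → ℂ) :
    ∏ j ∈ s, ‖x j‖ₑ⁻¹ = ‖∏ j ∈ s, x j‖ₑ⁻¹ := by
  classical
  induction s using Finset.induction_on with
  | empty => simp
  | insert i s hi ih =>
    rw [Finset.prod_insert hi, Finset.prod_insert hi, ih, enorm_mul,
      ENNReal.mul_inv (Or.inr enorm_ne_top) (Or.inl enorm_ne_top)]

lemma RapidDecay.tendsto_prod_inv {a : ℕ → ℂ} (ha : RapidDecay a) {n : ℕ} (z : Fin n → ℂ) :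
    Filter.Tendsto (fun N => ∏ j, ‖gaussianPartialSum N a (z j)‖ₑ⁻¹) Filter.atTop
      (nhds (∏ j, ‖gaussianSeries a (z j)‖ₑ⁻¹)) := by
  simp only [prod_enorm_inv]
  exact ((tendsto_finsetProd _ fun j _ => ha.tendsto_gaussianPartialSum (z j)).enorm).inv

/-- Lower tail of `logMean`: Markov's inequality for `exp (-n * logMean)`. The limit from partial sums
to the series is taken by Fatou's lemma, through the measurable majorant `H`. -/
lemma measure_logMean_le {n k₀ : ℕ} (hn : 0 < n) {r d : ℝ}
    (hr : 0 < r) (hd : 0 < d)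
    (hdk : ∀ k, k₀ ≤ k → k < k₀ + n → d ≤ radialWeight r k) (L : ℝ) :
    gaussianSeq {a | logMean (gaussianSeries a) r ≤ L}
      ≤ ENNReal.ofReal (Real.exp (n * L) * (3 * Real.exp (r ^ 2 / 2) / d ^ 2) ^ n) := by
  set C := ENNReal.ofReal ((3 * Real.exp (r ^ 2 / 2) / d ^ 2) ^ n) with hC
  have hpi : 0 < 2 * Real.pi := by positivity
  set G : ℕ → (ℕ → ℂ) → ℝ → ENNReal := fun N a θ =>
    ∏ j : Fin n, ‖gaussianPartialSum N a (circleMap 0 r (θ + 2 * Real.pi * j / n))‖ₑ⁻¹ with hG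
  have hGm : ∀ N, Measurable (Function.uncurry (G N)) := by
    intro N
    refine Finset.measurable_prod _ fun j _ => Measurable.inv (Measurable.enorm ?_)
    refine (measurable_gaussianPartialSum N).comp (measurable_fst.prodMk ?_)
    exact ((continuous_circleMap 0 r).measurable.comp
      (measurable_id.add_const (2 * Real.pi * j / n))).comp measurable_snd
  set I : ℕ → (ℕ → ℂ) → ENNReal := fun N a => ∫⁻ θ in Set.Ioc 0 (2 * Real.pi), G N a θ with hI
  have hIm : ∀ N, Measurable (I N) := fun N => (hGm N).lintegral_prod_right'
  set H : (ℕ → ℂ) → ENNReal := fun a =>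
    ENNReal.ofReal (2 * Real.pi)⁻¹ * Filter.liminf (fun N => I N a) Filter.atTop with hH
  have hHm : Measurable H := (Measurable.liminf hIm).const_mul _
  have hIle : ∀ N, k₀ + n ≤ N → ∫⁻ a, I N a ∂gaussianSeq ≤ ENNReal.ofReal (2 * Real.pi) * C := by
    intro N hN
    rw [hI, lintegral_lintegral_swap (hGm N).aemeasurable]
    refine (lintegral_mono fun θ =>
      lintegral_prod_inv_partialSum_le hn hN hr hd hdk θ).trans (le_of_eq ?_)
    rw [lintegral_const, Measure.restrict_apply_univ, Real.volume_Ioc, sub_zero, mul_comm]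
  have hHint : ∫⁻ a, H a ∂gaussianSeq ≤ C := by
    rw [hH, lintegral_const_mul _ (Measurable.liminf hIm)]
    have h1 : ∫⁻ a, Filter.liminf (fun N => I N a) Filter.atTop ∂gaussianSeq
        ≤ ENNReal.ofReal (2 * Real.pi) * C := by
      refine (lintegral_liminf_le hIm).trans ?_
      refine Filter.liminf_le_of_frequently_le' (Filter.Eventually.frequently ?_)
      filter_upwards [Filter.eventually_ge_atTop (k₀ + n)] with N hN using hIle N hN
    refine (mul_le_mul_right h1 _).trans (le_of_eq ?_)
    rw [← mul_assoc, ← ENNReal.ofReal_mul (inv_nonneg.2 hpi.le), inv_mul_cancel₀ hpi.ne']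
    simp
  have hle : ∀ᵐ a ∂gaussianSeq,
      ENNReal.ofReal (Real.exp (-(n * logMean (gaussianSeries a) r))) ≤ H a := by
    filter_upwards [ae_rapidDecay] with a ha
    refine (ofReal_exp_neg_logMean_le ha.differentiable r n).trans ?_
    rw [hH]
    refine mul_le_mul_right ?_ _
    have hGa : ∀ N, Measurable (G N a) := fun N => (hGm N).of_uncurry_left
    refine le_trans (lintegral_mono fun θ => ?_) (lintegral_liminf_le hGa)
    exact (ha.tendsto_prod_inv fun j : Fin n =>
      circleMap 0 r (θ + 2 * Real.pi * j / n)).liminf_eq.ge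
  have hsub : gaussianSeq {a | logMean (gaussianSeries a) r ≤ L}
      ≤ gaussianSeq {a | ENNReal.ofReal (Real.exp (-(n * L))) ≤ H a} := by
    refine measure_mono_ae ?_
    filter_upwards [hle] with a ha hL
    refine le_trans (ENNReal.ofReal_le_ofReal (Real.exp_le_exp.2 (neg_le_neg ?_))) ha
    exact mul_le_mul_of_nonneg_left hL (Nat.cast_nonneg n)
  refine hsub.trans ((meas_ge_le_lintegral_div hHm.aemeasurable
    (by simpa using Real.exp_pos _) ENNReal.ofReal_ne_top).trans ?_)
  rw [ENNReal.div_eq_inv_mul, ← ENNReal.ofReal_inv_of_pos (Real.exp_pos _), ← Real.exp_neg, neg_neg,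
    ENNReal.ofReal_mul (Real.exp_pos _).le]
  gcongr

/-- Jensen's inequality for `exp` and a probability distribution `p` on `ℕ`. -/
lemma ofReal_exp_weighted_sum_le {p x : ℕ → ℝ} (hp : ∀ k, 0 ≤ p k) (hp1 : HasSum p 1)
    (hx : Summable fun k => p k * x k) :
    ENNReal.ofReal (Real.exp (∑' k, p k * x k))
      ≤ ∑' k, ENNReal.ofReal (p k) * ENNReal.ofReal (Real.exp (x k)) := by
  simp_rw [← ENNReal.ofReal_mul (hp _)]
  by_cases htop : ∑' k, ENNReal.ofReal (p k * Real.exp (x k)) = ⊤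
  · rw [htop]; exact le_top
  have hnn : ∀ k, 0 ≤ p k * Real.exp (x k) := fun k => mul_nonneg (hp k) (Real.exp_pos _).le
  have hs : Summable fun k => p k * Real.exp (x k) := by
    refine (ENNReal.summable_toReal htop).congr fun k => ?_
    exact ENNReal.toReal_ofReal (hnn k)
  rw [← ENNReal.ofReal_tsum_of_nonneg hnn hs]
  refine ENNReal.ofReal_le_ofReal ?_
  set m := ∑' k, p k * x k with hm
  have hsum : HasSum (fun k => Real.exp m * (p k * x k + (1 - m) * p k)) (Real.exp m) := by
    have := (hx.hasSum.add (hp1.mul_left (1 - m))).mul_left (Real.exp m)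
    rw [← hm] at this
    have e : Real.exp m * (m + (1 - m) * 1) = Real.exp m := by ring
    rwa [e] at this
  refine hasSum_le (fun k => ?_) hsum hs.hasSum
  have h := Real.add_one_le_exp (x k - m)
  calc Real.exp m * (p k * x k + (1 - m) * p k) = p k * (Real.exp m * (x k - m + 1)) := by ring
    _ ≤ p k * (Real.exp m * Real.exp (x k - m)) := by have := hp k; gcongr
    _ = p k * Real.exp (x k) := by rw [← Real.exp_add]; ring_nf

/-- Upper tail of `logMean`: the sum `∑ k, radialWeight r k * ‖a k‖` dominates `‖ψ‖` on the circle, and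
its normalisation has exponential moment at most `expNormMean`. -/
lemma measure_le_logMean {r L : ℝ} (hr : 0 < r) (hL : 0 < L) :
    gaussianSeq {a | L ≤ logMean (gaussianSeries a) r}
      ≤ expNormMean * ENNReal.ofReal (Real.exp (-(Real.exp L / ∑' k, radialWeight r k))) := by
  have hsw := summable_radialWeight hr.le
  set Z := ∑' k, radialWeight r k with hZ
  have hZpos : 0 < Z := hsw.tsum_pos (radialWeight_nonneg hr.le) 0 (radialWeight_pos hr 0)
  set p : ℕ → ℝ := fun k => radialWeight r k / Z with hp
  have hp0 : ∀ k, 0 ≤ p k := fun k => div_nonneg (radialWeight_nonneg hr.le k) hZpos.le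
  have hp1 : HasSum p 1 := by
    have := hsw.hasSum.div_const Z
    rwa [← hZ, div_self hZpos.ne'] at this
  set H : (ℕ → ℂ) → ENNReal := fun a =>
    ∑' k, ENNReal.ofReal (p k) * ENNReal.ofReal (Real.exp ‖a k‖) with hH
  have hmeas : ∀ k, Measurable fun a : ℕ → ℂ =>
      ENNReal.ofReal (p k) * ENNReal.ofReal (Real.exp ‖a k‖) := fun k =>
    ((Real.measurable_exp.comp (measurable_pi_apply k).norm).ennreal_ofReal).const_mul _
  have hHint : ∫⁻ a, H a ∂gaussianSeq = expNormMean := by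
    rw [hH, lintegral_tsum fun k => (hmeas k).aemeasurable]
    have : ∀ k, ∫⁻ a, ENNReal.ofReal (p k) * ENNReal.ofReal (Real.exp ‖a k‖) ∂gaussianSeq
        = ENNReal.ofReal (p k) * expNormMean := fun k => by
      rw [lintegral_eval_gaussianSeq
        (f := fun w => ENNReal.ofReal (p k) * ENNReal.ofReal (Real.exp ‖w‖)) (by fun_prop) k,
        lintegral_const_mul _ (by fun_prop), expNormMean]
    simp_rw [this]
    rw [ENNReal.tsum_mul_right, ← ENNReal.ofReal_tsum_of_nonneg hp0 hp1.summable, hp1.tsum_eq]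
    simp
  have hsub : gaussianSeq {a | L ≤ logMean (gaussianSeries a) r}
      ≤ gaussianSeq {a | ENNReal.ofReal (Real.exp (Real.exp L / Z)) ≤ H a} := by
    refine measure_mono_ae ?_
    filter_upwards [ae_rapidDecay] with a ha hLa
    have hS : Summable fun k => ‖a k‖ * radialWeight r k := ha r hr.le
    set S := ∑' k, ‖a k‖ * radialWeight r k with hSdef
    -- the maximum with `0` accounts for the convention `log 0 = 0` at zeros on the circle
    have hfS : ∀ z ∈ Metric.sphere (0 : ℂ) |r|,
        Real.log ‖gaussianSeries a z‖ ≤ max (Real.log S) 0 := by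
      intro z hz
      rw [mem_sphere_zero_iff_norm, abs_of_pos hr] at hz
      rcases eq_or_ne (gaussianSeries a z) 0 with h0 | h0
      · simp [h0]
      refine le_max_of_le_left (Real.log_le_log (norm_pos_iff.2 h0) ?_)
      refine tsum_of_norm_bounded hS.hasSum fun k => ?_
      rw [norm_gaussianSeries_term, hz]
      rfl
    have h1 : logMean (gaussianSeries a) r ≤ max (Real.log S) 0 :=
      Real.circleAverage_mono_on_of_le_circle
        (circleIntegrable_log_norm_of_differentiable ha.differentiable r) hfS
    have hLS : L ≤ Real.log S := by
      rcases le_max_iff.1 (hLa.trans h1) with h | h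
      · exact h
      · exact absurd h (not_le.2 hL)
    have hS0 : 0 < S := by
      refine lt_of_le_of_ne (tsum_nonneg fun k => mul_nonneg (norm_nonneg _)
        (radialWeight_nonneg hr.le k)) fun h => ?_
      rw [← h, Real.log_zero] at hLS
      linarith
    have hexp : Real.exp L ≤ S := by rwa [← Real.le_log_iff_exp_le hS0]
    have hSZ : HasSum (fun k => p k * ‖a k‖) (S / Z) := by
      have h := hS.hasSum.div_const Z
      have e : (fun k => p k * ‖a k‖) = fun k => ‖a k‖ * radialWeight r k / Z := by
        ext k
        rw [hp]
        ring
      rwa [e]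
    have hJ := ofReal_exp_weighted_sum_le hp0 hp1 hSZ.summable
    rw [hSZ.tsum_eq] at hJ
    refine le_trans (ENNReal.ofReal_le_ofReal (Real.exp_le_exp.2 ?_)) hJ
    gcongr
  refine hsub.trans ((meas_ge_le_lintegral_div (Measurable.tsum hmeas).aemeasurable
    (by simpa using Real.exp_pos _) ENNReal.ofReal_ne_top).trans (le_of_eq ?_))
  rw [hHint, ENNReal.div_eq_inv_mul, ← ENNReal.ofReal_inv_of_pos (Real.exp_pos _), ← Real.exp_neg,
    mul_comm]

/-! ### Decay of the tails for large radii -/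

/-- Stirling's bound `k! ≤ e k (k / e) ^ k`. -/
lemma log_factorial_le {k : ℕ} (hk : 1 ≤ k) :
    Real.log (Nat.factorial k) ≤ (k + 1) * Real.log k - k + 1 := by
  induction k, hk using Nat.le_induction with
  | base => simp
  | succ k hk ih =>
    have hk0 : (0 : ℝ) < k := by exact_mod_cast hk
    have h1 : Real.log (k / (k + 1)) ≤ k / (k + 1) - 1 :=
      Real.log_le_sub_one_of_pos (by positivity)
    rw [Real.log_div hk0.ne' (by positivity)] at h1
    have h2 : (k : ℝ) / (k + 1) - 1 = -(1 / (k + 1)) := by field_simp; ring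
    rw [h2] at h1
    have h3 : (k + 1 : ℝ) * (Real.log k - Real.log (k + 1)) ≤ -1 := by
      calc (k + 1 : ℝ) * (Real.log k - Real.log (k + 1)) ≤ (k + 1 : ℝ) * -(1 / (k + 1)) := by gcongr
        _ = -1 := by field_simp
    rw [Nat.factorial_succ, Nat.cast_mul, Real.log_mul (by positivity) (by positivity)]
    push_cast
    nlinarith

/-- Near the maximum at `k ≈ r²`, the squared weight `r ^ (2 * k) / k!` is at least `exp r²` up to a
loss of `s² / r² + log (r² + s) + 1` in the exponent, where `s` is the distance to `r²`. -/
lemma exp_le_radialWeight {r s : ℝ} (hr : 1 ≤ r) {k : ℕ} (hk : r ^ 2 ≤ k)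
    (hks : (k : ℝ) ≤ r ^ 2 + s) :
    Real.exp ((r ^ 2 - s ^ 2 / r ^ 2 - 1 - Real.log (r ^ 2 + s)) / 2) ≤ radialWeight r k := by
  have hx : 1 ≤ r ^ 2 := one_le_pow₀ hr
  have hk1 : (1 : ℝ) ≤ k := hx.trans hk
  have hk1' : 1 ≤ k := by exact_mod_cast hk1
  have hw : 0 < radialWeight r k := radialWeight_pos (by linarith) k
  rw [← Real.le_log_iff_exp_le hw]
  have hlogw : Real.log (radialWeight r k)
      = (k * Real.log (r ^ 2) - Real.log (Nat.factorial k)) / 2 := by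
    rw [radialWeight, Real.log_div (by positivity) (by positivity), Real.log_pow,
      Real.log_sqrt (by positivity), Real.log_pow]
    push_cast; ring
  rw [hlogw]
  have h1 := log_factorial_le hk1'
  have h2 : Real.log (k / r ^ 2) ≤ k / r ^ 2 - 1 := Real.log_le_sub_one_of_pos (by positivity)
  rw [Real.log_div (by positivity) (by positivity)] at h2
  have h3 : Real.log k ≤ Real.log (r ^ 2 + s) := Real.log_le_log (by positivity) hks
  set x := r ^ 2 with hxdef
  have hx0 : 0 < x := by linarith
  have h4 : (k : ℝ) * (Real.log k - Real.log x) ≤ k * (k / x - 1) := by gcongr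
  have h5 : (k : ℝ) * (k / x - 1) ≤ (k - x) + s ^ 2 / x := by
    have e : (k : ℝ) * (k / x - 1) = (k - x) + (k - x) ^ 2 / x := by field_simp; ring
    rw [e]
    have : (k - x : ℝ) ^ 2 ≤ s ^ 2 := pow_le_pow_left₀ (by linarith) (by linarith) 2
    gcongr
  linarith

open Filter in
lemma eventually_measure_logMean_le {η : ℝ} (hη : 0 < η) (hη1 : η ≤ 1) :
    ∀ᶠ r : ℝ in atTop, gaussianSeq {a | logMean (gaussianSeries a) r ≤ (1 / 2 - η) * r ^ 2}
      ≤ ENNReal.ofReal (Real.exp (-(η ^ 2 / 16) * r ^ 4)) := by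
  have hsq : Tendsto (fun r : ℝ => r ^ 2) atTop atTop := tendsto_pow_atTop two_ne_zero
  have hlog : ∀ᶠ x : ℝ in atTop, 1 + Real.log (2 * x) ≤ η / 4 * x := by
    have h1 := Real.isLittleO_log_id_atTop.def (show 0 < η / 8 by positivity)
    filter_upwards [h1, eventually_ge_atTop (1 : ℝ),
      eventually_ge_atTop ((1 + Real.log 2) / (η / 8))] with x hx hx1 hx2
    rw [div_le_iff₀ (by positivity)] at hx2
    simp only [id, Real.norm_eq_abs] at hx
    rw [abs_of_nonneg (by linarith : 0 ≤ x)] at hx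
    rw [Real.log_mul two_ne_zero (by linarith)]
    have := (le_abs_self _).trans hx
    linarith
  filter_upwards [hsq.eventually hlog, hsq.eventually_ge_atTop (8 / η), eventually_ge_atTop (1 : ℝ),
    hsq.eventually_ge_atTop (4 * Real.log 3 / η)] with r hr hr8 hr1 hr3
  set x := r ^ 2 with hx
  have hx1 : 1 ≤ x := one_le_pow₀ hr1
  have hx0 : 0 < x := by linarith
  rw [div_le_iff₀ hη] at hr8 hr3
  -- a block of `n ≈ η r² / 4` consecutive indices starting at the maximal term
  set n := ⌈η / 4 * x⌉₊ with hn
  set k₀ := ⌈x⌉₊ with hk₀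
  have hn0 : 0 < n := Nat.ceil_pos.2 (by positivity)
  have hnx : η / 4 * x ≤ n := Nat.le_ceil _
  have hnx' : (n : ℝ) < η / 4 * x + 1 := Nat.ceil_lt_add_one (by positivity)
  have hkx : x ≤ k₀ := Nat.le_ceil _
  have hkx' : (k₀ : ℝ) < x + 1 := Nat.ceil_lt_add_one hx0.le
  have hw : ∀ k, k₀ ≤ k → k < k₀ + n → Real.exp (x * (1 - η / 2) / 2) ≤ radialWeight r k := by
    intro k hk1 hk2
    have hk1' : (k₀ : ℝ) ≤ k := by exact_mod_cast hk1
    have hk2' : (k : ℝ) < k₀ + n := by exact_mod_cast hk2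
    refine le_trans (Real.exp_le_exp.2 ?_)
      (exp_le_radialWeight (s := η / 2 * x) hr1 (hkx.trans hk1') (by nlinarith))
    rw [← hx]
    have e1 : (η / 2 * x) ^ 2 / x ≤ η / 4 * x := by
      have : (η / 2 * x) ^ 2 / x = η ^ 2 / 4 * x := by field_simp; ring
      rw [this]
      gcongr
      nlinarith
    have e2 : Real.log (x + η / 2 * x) ≤ Real.log (2 * x) :=
      Real.log_le_log (by positivity) (by nlinarith)
    linarith
  refine (measure_logMean_le hn0 (by linarith) (Real.exp_pos _) hw _).trans
    (ENNReal.ofReal_le_ofReal ?_)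
  have hd2 : Real.exp (x * (1 - η / 2) / 2) ^ 2 = Real.exp (x * (1 - η / 2)) := by
    rw [← Real.exp_nat_mul]; congr 1; push_cast; ring
  have h3 : (3 : ℝ) ≤ Real.exp (η / 4 * x) := by
    rw [← Real.log_le_iff_le_exp (by norm_num)]
    linarith
  rw [hd2, Real.exp_nat_mul, ← mul_pow]
  have hbase : Real.exp ((1 / 2 - η) * x) * (3 * Real.exp (x / 2) / Real.exp (x * (1 - η / 2)))
      ≤ Real.exp (-(η / 4) * x) := by
    calc _ ≤ Real.exp ((1 / 2 - η) * x) *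
          (Real.exp (η / 4 * x) * Real.exp (x / 2) / Real.exp (x * (1 - η / 2))) := by gcongr
      _ = Real.exp (-(η / 4) * x) := by
        rw [← Real.exp_add, ← Real.exp_sub, ← Real.exp_add]; ring_nf
  refine (pow_le_pow_left₀ (by positivity) hbase n).trans ?_
  rw [← Real.exp_nat_mul]
  refine Real.exp_le_exp.2 ?_
  have e4 : r ^ 4 = x * x := by rw [hx]; ring
  rw [e4]
  have := mul_le_mul_of_nonneg_right hnx (by positivity : 0 ≤ η / 4 * x)
  linarith

open Filter in
lemma eventually_measure_le_logMean {η : ℝ} (hη : 0 < η) :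
    ∀ᶠ r : ℝ in atTop, gaussianSeq {a | (1 / 2 + η) * r ^ 2 ≤ logMean (gaussianSeries a) r}
      ≤ ENNReal.ofReal (Real.exp (-r ^ 4)) := by
  have hsq : Tendsto (fun r : ℝ => r ^ 2) atTop atTop := tendsto_pow_atTop two_ne_zero
  set q := Real.sqrt (1 + η) with hq
  have hq2 : q ^ 2 = 1 + η := Real.sq_sqrt (by linarith)
  have hq1 : 1 < q := by rw [hq, Real.lt_sqrt zero_le_one]; linarith
  set C := 1 + (1 - (q⁻¹) ^ 2)⁻¹ with hC
  have hC0 : 0 < C := by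
    have h1 : (q⁻¹) ^ 2 < 1 := pow_lt_one₀ (by positivity) (inv_lt_one_of_one_lt₀ hq1) two_ne_zero
    have h2 : 0 < (1 - (q⁻¹) ^ 2)⁻¹ := inv_pos.2 (by linarith)
    linarith
  set E := expNormMean.toReal with hE
  -- `exp (η x / 2)` beats any quadratic polynomial
  have hbig : ∀ᶠ x : ℝ in atTop, C * (x ^ 2 + E) ≤ Real.exp (η / 2 * x) := by
    have h1 : ∀ᶠ x : ℝ in atTop, 2 * C ≤ Real.exp (η / 2 * x) / x ^ (2 : ℝ) :=
      (tendsto_exp_mul_div_rpow_atTop 2 (η / 2) (by positivity)).eventually_ge_atTop _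
    filter_upwards [h1, eventually_ge_atTop (1 : ℝ), eventually_ge_atTop E] with x hx hx1 hxE
    rw [le_div_iff₀ (by positivity), Real.rpow_two] at hx
    have h2 : x ^ 2 + E ≤ 2 * x ^ 2 := by nlinarith
    have h3 := mul_le_mul_of_nonneg_left h2 hC0.le
    linarith
  filter_upwards [hsq.eventually hbig, eventually_gt_atTop (0 : ℝ)] with r hr hr0
  set x := r ^ 2 with hx
  have hx0 : 0 < x := by positivity
  refine (measure_le_logMean hr0 (by positivity)).trans ?_
  have hZ := tsum_radialWeight_le hr0.le hq1
  have hZpos : 0 < ∑' k, radialWeight r k :=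
    (summable_radialWeight hr0.le).tsum_pos (radialWeight_nonneg hr0.le) 0 (radialWeight_pos hr0 0)
  rw [hq2, ← hC, ← hx] at hZ
  have hexp : x ^ 2 + E ≤ Real.exp ((1 / 2 + η) * x) / ∑' k, radialWeight r k := by
    rw [le_div_iff₀ hZpos]
    have hE0 : 0 ≤ E := ENNReal.toReal_nonneg
    calc (x ^ 2 + E) * ∑' k, radialWeight r k
        ≤ (x ^ 2 + E) * (C * Real.exp ((1 + η) * x / 2)) := by gcongr
      _ = C * (x ^ 2 + E) * Real.exp ((1 + η) * x / 2) := by ring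
      _ ≤ Real.exp (η / 2 * x) * Real.exp ((1 + η) * x / 2) := by gcongr
      _ = _ := by rw [← Real.exp_add]; ring_nf
  rw [← ENNReal.ofReal_toReal expNormMean_lt_top.ne, ← hE, ← ENNReal.ofReal_mul
    ENNReal.toReal_nonneg]
  refine ENNReal.ofReal_le_ofReal ?_
  have h1 : E ≤ Real.exp E := by linarith [Real.add_one_le_exp E]
  calc E * Real.exp (-(Real.exp ((1 / 2 + η) * x) / ∑' k, radialWeight r k))
      ≤ Real.exp E * Real.exp (-(x ^ 2 + E)) := by gcongr
    _ = Real.exp (-r ^ 4) := by rw [← Real.exp_add, hx]; ring_nf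

/-! ### Bounded radii: one dominant coefficient -/

lemma abs_log_norm_sub_le {u v : ℂ} (hv : v ≠ 0) (h : ‖u - v‖ ≤ ‖v‖ / 10) :
    |Real.log ‖u‖ - Real.log ‖v‖| ≤ 1 / 9 := by
  have hv0 : 0 < ‖v‖ := norm_pos_iff.2 hv
  have h1 : ‖u‖ ≤ ‖v‖ + ‖v‖ / 10 := by
    calc ‖u‖ = ‖v + (u - v)‖ := by ring_nf
      _ ≤ ‖v‖ + ‖u - v‖ := norm_add_le _ _
      _ ≤ _ := by linarith
  have h2 : ‖v‖ - ‖v‖ / 10 ≤ ‖u‖ := by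
    have := norm_sub_norm_le v u
    rw [norm_sub_rev] at this
    linarith
  have hu0 : 0 < ‖u‖ := by linarith
  rw [abs_le]
  constructor
  · have h3 := Real.log_le_sub_one_of_pos (div_pos hv0 hu0)
    rw [Real.log_div hv0.ne' hu0.ne'] at h3
    have : ‖v‖ / ‖u‖ ≤ 10 / 9 := by rw [div_le_iff₀ hu0]; linarith
    linarith
  · have h3 := Real.log_le_sub_one_of_pos (div_pos hu0 hv0)
    rw [Real.log_div hu0.ne' hv0.ne'] at h3
    have : ‖u‖ / ‖v‖ ≤ 11 / 10 := by rw [div_le_iff₀ hv0]; linarith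
    linarith

lemma abs_logMean_sub_le {f : ℂ → ℂ} (hf : Differentiable ℂ f) {R : ℝ} (hR : 0 < R) {b : ℂ}
    (hb : b ≠ 0) (m : ℕ) (h : ∀ z : ℂ, ‖z‖ = R → ‖f z - b * z ^ m‖ ≤ ‖b * z ^ m‖ / 10) :
    |logMean f R - (Real.log ‖b‖ + m * Real.log R)| ≤ 1 / 9 := by
  set c := Real.log ‖b‖ + m * Real.log R with hc
  have hpt : ∀ z ∈ Metric.sphere (0 : ℂ) |R|, |Real.log ‖f z‖ - c| ≤ 1 / 9 := by
    intro z hz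
    rw [mem_sphere_zero_iff_norm, abs_of_pos hR] at hz
    have hz0 : z ≠ 0 := by rw [← norm_pos_iff, hz]; exact hR
    have hlog : Real.log ‖b * z ^ m‖ = c := by
      rw [norm_mul, norm_pow, hz, Real.log_mul (norm_ne_zero_iff.2 hb) (by positivity), Real.log_pow]
    rw [← hlog]
    exact abs_log_norm_sub_le (mul_ne_zero hb (pow_ne_zero _ hz0)) (h z hz)
  have hci := circleIntegrable_log_norm_of_differentiable hf R
  have hup : logMean f R ≤ c + 1 / 9 := Real.circleAverage_mono_on_of_le_circle hci fun z hz => by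
    have := (abs_le.1 (hpt z hz)).2; linarith
  have hlow : c - 1 / 9 ≤ logMean f R := by
    have h1 := Real.circleAverage_mono (f₁ := fun _ => c - 1 / 9) (c := 0) (R := R)
      (circleIntegrable_const _ _ _) hci fun z hz => by
        have := (abs_le.1 (hpt z hz)).1; linarith
    rwa [Real.circleAverage_const] at h1
  rw [abs_le]
  constructor <;> linarith

/-- A dominant monomial of degree `m` on the circles of radii `r / 2`, `r` and `2 * r` forces exactly
`m` zeros in `|z| ≤ r`: the growth of `logMean` determines the count up to an error below one. -/
lemma zeroCount_eq_of_dominant {f : ℂ → ℂ} (hf : Differentiable ℂ f) {r : ℝ} (hr : 0 < r) {b : ℂ}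
    (hb : b ≠ 0) (m : ℕ) (h : ∀ z : ℂ, r / 2 ≤ ‖z‖ → ‖z‖ ≤ 2 * r →
      ‖f z - b * z ^ m‖ ≤ ‖b * z ^ m‖ / 10) : zeroCount f r = m := by
  have key : ∀ R, 0 < R → r / 2 ≤ R → R ≤ 2 * r →
      |logMean f R - (Real.log ‖b‖ + m * Real.log R)| ≤ 1 / 9 := fun R h0 h1 h2 =>
    abs_logMean_sub_le hf h0 hb m fun z hz => h z (by rw [hz]; exact h1) (by rw [hz]; exact h2)
  have k1 := abs_le.1 (key (r / 2) (by linarith) le_rfl (by linarith))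
  have k2 := abs_le.1 (key r hr (by linarith) (by linarith))
  have k3 := abs_le.1 (key (2 * r) (by linarith) (by linarith) le_rfl)
  have j1 := (zeroCount_mul_log_le hf (R₁ := r / 2) (R₂ := r) (by linarith) (by linarith)).2
  have j2 := (zeroCount_mul_log_le hf (R₁ := r) (R₂ := 2 * r) hr (by linarith)).1
  rw [show r / (r / 2) = 2 by field_simp] at j1
  rw [show 2 * r / r = 2 by field_simp] at j2
  rw [Real.log_div hr.ne' two_ne_zero] at k1
  rw [Real.log_mul two_ne_zero hr.ne'] at k3
  have hl := Real.log_two_gt_d9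
  have hlt : ((zeroCount f r : ℝ) - m) * Real.log 2 < Real.log 2 := by nlinarith
  have hgt : -Real.log 2 < ((zeroCount f r : ℝ) - m) * Real.log 2 := by nlinarith
  have h1 : (zeroCount f r : ℝ) < m + 1 := by
    by_contra hc
    nlinarith
  have h2 : (m : ℝ) < zeroCount f r + 1 := by
    by_contra hc
    nlinarith
  have h1' : zeroCount f r < m + 1 := by exact_mod_cast h1
  have h2' : m < zeroCount f r + 1 := by exact_mod_cast h2
  omega

lemma stdComplexGaussian_norm_ge_pos (T : ℝ) : 0 < stdComplexGaussian {w | T ≤ ‖w‖} := by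
  have hopen : IsOpen {w : ℂ | T < ‖w‖} := isOpen_lt continuous_const continuous_norm
  have hne : {w : ℂ | T < ‖w‖}.Nonempty := by
    refine ⟨((|T| + 1 : ℝ) : ℂ), ?_⟩
    change T < ‖((|T| + 1 : ℝ) : ℂ)‖
    rw [Complex.norm_real, Real.norm_of_nonneg (by positivity)]
    linarith [le_abs_self T]
  have hsub : {w : ℂ | T < ‖w‖} ⊆ {w : ℂ | T ≤ ‖w‖} :=
    fun w (hw : T < ‖w‖) => show T ≤ ‖w‖ from hw.le
  have hvol : volume {w : ℂ | T ≤ ‖w‖} ≠ 0 := fun h0 =>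
    (hopen.measure_pos volume hne).ne' (measure_mono_null hsub h0)
  refine pos_iff_ne_zero.2 fun h0 => hvol ?_
  rw [stdComplexGaussian, withDensity_apply_eq_zero (by fun_prop)] at h0
  have hsupp : {w : ℂ | ENNReal.ofReal (Real.pi⁻¹ * Real.exp (-‖w‖ ^ 2)) ≠ 0} = Set.univ := by
    ext w
    simp only [Set.mem_ofPred_eq, Set.mem_univ, iff_true, ne_eq, ENNReal.ofReal_eq_zero, not_le]
    positivity
  rwa [hsupp, Set.univ_inter] at h0

/-- The total size on `|z| = ρ` of all terms of the series except the `m`-th. -/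
noncomputable def offSum (m : ℕ) (ρ : ℝ) (a : ℕ → ℂ) : ENNReal :=
  ∑' k, if k = m then 0 else ENNReal.ofReal (radialWeight ρ k) * ‖a k‖ₑ

lemma measurable_offSum_term (m : ℕ) (ρ : ℝ) (k : ℕ) : Measurable fun a : ℕ → ℂ =>
    if k = m then 0 else ENNReal.ofReal (radialWeight ρ k) * ‖a k‖ₑ := by
  split_ifs
  · exact measurable_const
  · exact (measurable_pi_apply k).enorm.const_mul _

/-- Since `a m` is independent of `offSum m ρ`, Markov's inequality bounds `offSum` on half of the event
`T ≤ ‖a m‖`, by a constant `B` that does not depend on `T`. -/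
lemma exists_measure_offSum_le (m : ℕ) {ρ : ℝ} (hρ : 0 ≤ ρ) : ∃ B : ℝ, 0 < B ∧ ∀ T : ℝ,
    stdComplexGaussian {w | T ≤ ‖w‖} / 2
      ≤ gaussianSeq {a | T ≤ ‖a m‖ ∧ offSum m ρ a < ENNReal.ofReal B} := by
  set K : ENNReal := ∑' k, ENNReal.ofReal (radialWeight ρ k) * expNormMean with hK
  have hKtop : K ≠ ⊤ := by
    rw [hK, ENNReal.tsum_mul_right, ← ENNReal.ofReal_tsum_of_nonneg (radialWeight_nonneg hρ)
        (summable_radialWeight hρ)]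
    exact (ENNReal.mul_lt_top ENNReal.ofReal_lt_top expNormMean_lt_top).ne
  refine ⟨2 * K.toReal + 1, by positivity, fun T => ?_⟩
  set B := ENNReal.ofReal (2 * K.toReal + 1) with hB
  have hKB : 2 * K ≤ B := by
    rw [hB, ← ENNReal.ofReal_toReal hKtop, show (2 : ENNReal) = ENNReal.ofReal 2 by simp,
      ← ENNReal.ofReal_mul two_pos.le, ENNReal.toReal_ofReal ENNReal.toReal_nonneg]
    exact ENNReal.ofReal_le_ofReal (by linarith)
  have hB0 : B ≠ 0 := by rw [hB]; simp; positivity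
  have hBtop : B ≠ ⊤ := ENNReal.ofReal_ne_top
  set p := stdComplexGaussian {w | T ≤ ‖w‖} with hp
  have hAm : MeasurableSet {w : ℂ | T ≤ ‖w‖} := measurableSet_le measurable_const measurable_norm
  set F : Set (ℕ → ℂ) := {a | T ≤ ‖a m‖} with hF
  have hFm : MeasurableSet F := hAm.preimage (measurable_pi_apply m)
  have hFp : gaussianSeq F = p :=
    (measurePreserving_eval_infinitePi (fun _ : ℕ => stdComplexGaussian) m).measure_preimage
      hAm.nullMeasurableSet
  have hSm : Measurable (offSum m ρ) := Measurable.tsum (measurable_offSum_term m ρ)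
  have hterm : ∀ k, ∫⁻ a in F, (if k = m then 0 else ENNReal.ofReal (radialWeight ρ k) * ‖a k‖ₑ)
      ∂gaussianSeq ≤ p * (ENNReal.ofReal (radialWeight ρ k) * expNormMean) := by
    intro k
    by_cases hkm : k = m
    · simp [hkm]
    simp only [hkm, if_false]
    have hind : IndepFun (fun a : ℕ → ℂ => ({w : ℂ | T ≤ ‖w‖}.indicator (1 : ℂ → ENNReal)) (a m))
        (fun a : ℕ → ℂ => ENNReal.ofReal (radialWeight ρ k) * ‖a k‖ₑ) gaussianSeq :=
      (iIndepFun_gaussianSeq.indepFun (Ne.symm hkm)).comp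
        (φ := {w : ℂ | T ≤ ‖w‖}.indicator (1 : ℂ → ENNReal))
        (ψ := fun w => ENNReal.ofReal (radialWeight ρ k) * ‖w‖ₑ)
        (measurable_one.indicator hAm) (by fun_prop)
    have hm1 : Measurable fun a : ℕ → ℂ => ({w : ℂ | T ≤ ‖w‖}.indicator (1 : ℂ → ENNReal)) (a m) :=
      (measurable_one.indicator hAm).comp (measurable_pi_apply m)
    have hm2 : Measurable fun a : ℕ → ℂ => ENNReal.ofReal (radialWeight ρ k) * ‖a k‖ₑ :=
      (measurable_pi_apply k).enorm.const_mul _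
    have h1 := lintegral_mul_eq_lintegral_mul_lintegral_of_indepFun hm1 hm2 hind
    have h2 : ∫⁻ a : ℕ → ℂ, ({w : ℂ | T ≤ ‖w‖}.indicator (1 : ℂ → ENNReal)) (a m) ∂gaussianSeq
        = p := by
      rw [lintegral_eval_gaussianSeq (measurable_one.indicator hAm), lintegral_indicator_one hAm]
    have h3 : ∫⁻ a : ℕ → ℂ, ENNReal.ofReal (radialWeight ρ k) * ‖a k‖ₑ ∂gaussianSeq
        ≤ ENNReal.ofReal (radialWeight ρ k) * expNormMean := by
      rw [lintegral_const_mul _ (measurable_pi_apply k).enorm,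
        lintegral_eval_gaussianSeq measurable_enorm]
      gcongr
      exact lintegral_enorm_le
    rw [h2] at h1
    rw [← lintegral_indicator hFm]
    refine le_trans (le_of_eq ?_) (h1.le.trans (mul_le_mul_right h3 p))
    refine lintegral_congr fun a => ?_
    by_cases ha : T ≤ ‖a m‖ <;> simp [Set.indicator, hF, ha]
  have hint : ∫⁻ a in F, offSum m ρ a ∂gaussianSeq ≤ p * K := by
    unfold offSum
    rw [lintegral_tsum fun k => (measurable_offSum_term m ρ k).aemeasurable, hK,
      ← ENNReal.tsum_mul_left]
    exact ENNReal.tsum_le_tsum hterm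
  have hmarkov : gaussianSeq (F ∩ {a | B ≤ offSum m ρ a}) ≤ p / 2 := by
    have h1 := meas_ge_le_lintegral_div (μ := gaussianSeq.restrict F) hSm.aemeasurable hB0 hBtop
    rw [Measure.restrict_apply (measurableSet_le measurable_const hSm), Set.inter_comm] at h1
    refine h1.trans (ENNReal.div_le_of_le_mul (hint.trans ?_))
    calc p * K = p / 2 * (2 * K) := by
          rw [← mul_assoc, ENNReal.div_mul_cancel two_ne_zero ENNReal.ofNat_ne_top]
      _ ≤ p / 2 * B := by gcongr
  have hsplit : p ≤ gaussianSeq {a | T ≤ ‖a m‖ ∧ offSum m ρ a < B}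
      + gaussianSeq (F ∩ {a | B ≤ offSum m ρ a}) := by
    rw [← hFp]
    refine (measure_mono fun a ha => ?_).trans (measure_union_le _ _)
    rcases lt_or_ge (offSum m ρ a) B with h | h
    · exact Or.inl ⟨ha, h⟩
    · exact Or.inr ⟨ha, h⟩
  have hp2 : p / 2 ≠ ⊤ := by
    refine ENNReal.div_ne_top ?_ two_ne_zero
    rw [hp]; exact measure_ne_top _ _
  have h4 := hsplit.trans (add_le_add_right hmarkov _)
  nth_rewrite 1 [← ENNReal.add_halves p] at h4
  exact (ENNReal.add_le_add_iff_right hp2).1 h4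

lemma zeroCount_gaussianSeries_eq {a : ℕ → ℂ} (ha : RapidDecay a) {m : ℕ} {R₀ B : ℝ}
    (hB : 0 < B) (hoff : offSum m (2 * R₀) a < ENNReal.ofReal B)
    (ham : 10 * B * 2 ^ m * Real.sqrt (Nat.factorial m : ℝ) ≤ ‖a m‖) {r : ℝ} (hr1 : 1 ≤ r)
    (hrR : r ≤ R₀) : zeroCount (gaussianSeries a) r = m := by
  have hfac : 0 < Real.sqrt (Nat.factorial m : ℝ) := by positivity
  have ham0 : 0 < ‖a m‖ := lt_of_lt_of_le (by positivity) ham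
  set b : ℂ := a m / (Real.sqrt (Nat.factorial m : ℝ) : ℂ) with hb
  have hbn : ‖b‖ = ‖a m‖ / Real.sqrt (Nat.factorial m : ℝ) := by
    rw [hb, norm_div, Complex.norm_real, Real.norm_of_nonneg hfac.le]
  have hb0 : b ≠ 0 := by rw [← norm_pos_iff, hbn]; positivity
  refine zeroCount_eq_of_dominant ha.differentiable (by linarith) hb0 m fun z hz1 hz2 => ?_
  have hsum := ha.summable z
  have hsplit := hsum.tsum_eq_add_tsum_ite m
  have hterm : a m * (z ^ m / (Real.sqrt (Nat.factorial m : ℝ) : ℂ)) = b * z ^ m := by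
    rw [hb]; ring
  have hdiff : gaussianSeries a z - b * z ^ m
      = ∑' k, if k = m then 0 else a k * (z ^ k / (Real.sqrt (Nat.factorial k : ℝ) : ℂ)) := by
    rw [gaussianSeries, hsplit, hterm, add_sub_cancel_left]
  have hρ : ‖z‖ ≤ 2 * R₀ := by linarith
  have hle : ‖gaussianSeries a z - b * z ^ m‖ₑ ≤ offSum m (2 * R₀) a := by
    rw [hdiff]
    refine (enorm_tsum_le_tsum_enorm).trans (ENNReal.tsum_le_tsum fun k => ?_)
    split_ifs
    · simp
    · rw [← ofReal_norm, norm_gaussianSeries_term, ← ofReal_norm,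
        ← ENNReal.ofReal_mul (radialWeight_nonneg (by linarith) k), mul_comm]
      refine ENNReal.ofReal_le_ofReal ?_
      unfold radialWeight
      gcongr
  have hltB : ‖gaussianSeries a z - b * z ^ m‖ < B := by
    have := hle.trans_lt hoff
    rw [← ofReal_norm] at this
    exact (ENNReal.ofReal_lt_ofReal_iff hB).1 this
  refine hltB.le.trans ?_
  have hz : (1 / 2 : ℝ) ^ m ≤ ‖z‖ ^ m := pow_le_pow_left₀ (by norm_num) (by linarith) m
  have hbB : 10 * B * 2 ^ m ≤ ‖b‖ := by rw [hbn, le_div_iff₀ hfac]; exact ham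
  rw [norm_mul, norm_pow, le_div_iff₀ (by norm_num)]
  calc B * 10 = (10 * B * 2 ^ m) * (1 / 2) ^ m := by
        rw [mul_assoc, ← mul_pow]; norm_num; ring
    _ ≤ ‖b‖ * ‖z‖ ^ m := by gcongr

/-- On a bounded range of radii every fixed count `m` has probability bounded below. -/
lemma exists_measure_zeroCount_ne_le (m : ℕ) {R₀ : ℝ} (hR₀ : 0 ≤ R₀) : ∃ ε : ℝ, 0 < ε ∧ ∀ r : ℝ,
    1 ≤ r → r ≤ R₀ →
      gaussianSeq {a | zeroCount (gaussianSeries a) r ≠ m} ≤ ENNReal.ofReal (1 - ε) := by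
  obtain ⟨B, hB, hprob⟩ := exists_measure_offSum_le m (ρ := 2 * R₀) (by positivity)
  set T := 10 * B * 2 ^ m * Real.sqrt (Nat.factorial m : ℝ) with hT
  set p := stdComplexGaussian {w | T ≤ ‖w‖} / 2 with hp
  have hp0 : p ≠ 0 := by
    rw [hp]
    exact (ENNReal.div_pos (stdComplexGaussian_norm_ge_pos T).ne' ENNReal.ofNat_ne_top).ne'
  have hptop : p ≠ ⊤ := by
    rw [hp]; exact ENNReal.div_ne_top (measure_ne_top _ _) two_ne_zero
  refine ⟨p.toReal, ENNReal.toReal_pos hp0 hptop, fun r hr1 hrR => ?_⟩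
  set G : Set (ℕ → ℂ) := {a | T ≤ ‖a m‖ ∧ offSum m (2 * R₀) a < ENNReal.ofReal B} with hG
  have hGm : MeasurableSet G :=
    (measurableSet_le measurable_const (measurable_pi_apply m).norm).inter
      (measurableSet_lt (Measurable.tsum (measurable_offSum_term m _)) measurable_const)
  have hsub : gaussianSeq {a | zeroCount (gaussianSeries a) r ≠ m} ≤ gaussianSeq Gᶜ := by
    refine measure_mono_ae ?_
    filter_upwards [ae_rapidDecay] with a ha hne hGa
    exact hne (zeroCount_gaussianSeries_eq ha hB hGa.2 hGa.1 hr1 hrR)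
  refine hsub.trans ?_
  rw [prob_compl_eq_one_sub hGm, ENNReal.ofReal_sub _ ENNReal.toReal_nonneg, ENNReal.ofReal_one,
    ENNReal.ofReal_toReal hptop]
  exact tsub_le_tsub_left (hprob T) _

/-! ### The deviation estimate -/

lemma half_exp_sub_one_bounds {t : ℝ} (ht : 0 < t) (ht2 : t ≤ 1 / 2) :
    (Real.exp (2 * t) - 1) / 2 ≤ t + 2 * t ^ 2 ∧ t - 2 * t ^ 2 ≤ (1 - Real.exp (-(2 * t))) / 2 := by
  have h1 := abs_le.1 (Real.abs_exp_sub_one_sub_id_le (x := 2 * t)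
    (by rw [abs_le]; constructor <;> linarith))
  have h2 := abs_le.1 (Real.abs_exp_sub_one_sub_id_le (x := -(2 * t))
    (by rw [abs_le]; constructor <;> linarith))
  constructor <;> nlinarith [h1.2, h2.2]

/-- Deterministic step: if `logMean f R` is close to `R² / 2` at the radii `r e⁻ᵗ`, `r`, `r eᵗ`, then
`f` has close to `r²` zeros in `|z| ≤ r`. -/
lemma abs_zeroCount_div_lt {f : ℂ → ℂ} (hf : Differentiable ℂ f) {r δ η t : ℝ} (hr : 0 < r)
    (hδ : 0 < δ) (hδ' : δ ≤ 1 / 4) (ht : t = δ / 4) (hη : η = δ ^ 2 / 32)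
    (h₁ : logMean f (Real.exp t * r) < (1 / 2 + η) * (Real.exp t * r) ^ 2)
    (h₂ : (1 / 2 - η) * r ^ 2 < logMean f r)
    (h₃ : logMean f (Real.exp (-t) * r) < (1 / 2 + η) * (Real.exp (-t) * r) ^ 2) :
    |(zeroCount f r : ℝ) / r ^ 2 - 1| < δ := by
  have ht0 : 0 < t := by rw [ht]; positivity
  have ht1 : 1 < Real.exp t := Real.one_lt_exp_iff.2 ht0
  have ht1' : Real.exp (-t) < 1 := by
    rw [← Real.exp_zero]
    exact Real.exp_lt_exp.2 (by linarith)
  have hup := (zeroCount_mul_log_le hf (R₁ := r) (R₂ := Real.exp t * r) hr (by nlinarith)).1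
  have hlow := (zeroCount_mul_log_le hf (R₁ := Real.exp (-t) * r) (R₂ := r) (by positivity)
    (by nlinarith)).2
  rw [mul_div_cancel_right₀ _ hr.ne', Real.log_exp] at hup
  have hq : r / (Real.exp (-t) * r) = Real.exp t := by
    rw [Real.exp_neg]; field_simp
  rw [hq, Real.log_exp] at hlow
  have e1 : (Real.exp t * r) ^ 2 = Real.exp (2 * t) * r ^ 2 := by
    rw [mul_pow, ← Real.exp_nat_mul]; push_cast; rfl
  have e2 : (Real.exp (-t) * r) ^ 2 = Real.exp (-(2 * t)) * r ^ 2 := by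
    rw [mul_pow, ← Real.exp_nat_mul]; push_cast; ring_nf
  rw [e1] at h₁
  rw [e2] at h₃
  obtain ⟨b1, b2⟩ := half_exp_sub_one_bounds ht0 (by linarith)
  set x := r ^ 2 with hx
  have hx0 : 0 < x := by positivity
  set n : ℝ := (zeroCount f r : ℝ) with hn
  have hE1 : Real.exp (2 * t) ≤ 3 := by nlinarith
  have hE2 : Real.exp (-(2 * t)) ≤ 1 := Real.exp_le_one_iff.2 (by linarith)
  -- `2 t² = δ t / 2` and `4 η = δ t / 2`
  have c1 : 2 * t ^ 2 = δ * t / 2 := by rw [ht]; ring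
  have c2 : 4 * η = δ * t / 2 := by rw [ht, hη]; ring
  have hη0 : 0 < η := by rw [hη]; positivity
  have u1 : n * t < (1 + δ) * t * x := by
    have h5 : (1 / 2 + η) * Real.exp (2 * t) - (1 / 2 - η) ≤ (1 + δ) * t := by
      have := mul_le_mul_of_nonneg_left hE1 hη0.le
      linarith
    have := mul_le_mul_of_nonneg_right h5 hx0.le
    linarith
  have u2 : (1 - δ) * t * x < n * t := by
    have h5 : (1 - δ) * t ≤ (1 / 2 - η) - (1 / 2 + η) * Real.exp (-(2 * t)) := by
      have := mul_le_mul_of_nonneg_left hE2 hη0.le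
      linarith
    have := mul_le_mul_of_nonneg_right h5 hx0.le
    linarith
  have u1' : n < (1 + δ) * x := by
    by_contra hc
    have := mul_le_mul_of_nonneg_right (not_lt.1 hc) ht0.le
    linarith
  have u2' : (1 - δ) * x < n := by
    by_contra hc
    have := mul_le_mul_of_nonneg_right (not_lt.1 hc) ht0.le
    linarith
  rw [abs_lt]
  constructor
  · have := (lt_div_iff₀ hx0).2 u2'; linarith
  · have := (div_lt_iff₀ hx0).2 u1'; linarith

/-- The event that the normalised zero count deviates from one by at least `δ`. -/
def deviationSet (δ r : ℝ) : Set (ℕ → ℂ) :=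
  {a | δ ≤ |(zeroCount (gaussianSeries a) r : ℝ) / r ^ 2 - 1|}

open Filter in
lemma eventually_measure_deviationSet_le {δ : ℝ} (hδ : 0 < δ) (hδ' : δ ≤ 1 / 4) :
    ∃ c : ℝ, 0 < c ∧ ∀ᶠ r : ℝ in atTop,
      gaussianSeq (deviationSet δ r) ≤ ENNReal.ofReal (Real.exp (-c * r ^ 4)) := by
  obtain ⟨t, ht⟩ : ∃ t, t = δ / 4 := ⟨_, rfl⟩
  obtain ⟨η, hη⟩ : ∃ η, η = δ ^ 2 / 32 := ⟨_, rfl⟩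
  have hη0 : 0 < η := by rw [hη]; positivity
  have hη1 : η ≤ 1 := by rw [hη]; nlinarith
  set c₀ : ℝ := min (η ^ 2 / 16) (Real.exp (-t) ^ 4) with hc₀
  have hc₀pos : 0 < c₀ := lt_min (by positivity) (by positivity)
  have hscale : ∀ s : ℝ, Tendsto (fun r : ℝ => Real.exp s * r) atTop atTop := fun s =>
    tendsto_id.const_mul_atTop (Real.exp_pos s)
  have hfour : Tendsto (fun r : ℝ => r ^ 4) atTop atTop := tendsto_pow_atTop (by norm_num)
  refine ⟨c₀ / 2, by positivity, ?_⟩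
  filter_upwards [eventually_measure_logMean_le hη0 hη1,
    (hscale t).eventually (eventually_measure_le_logMean hη0),
    (hscale (-t)).eventually (eventually_measure_le_logMean hη0), eventually_gt_atTop (0 : ℝ),
    hfour.eventually_ge_atTop (Real.log 3 / (c₀ / 2))] with r hA hB hC hr hr4
  have hsub : gaussianSeq (deviationSet δ r) ≤ gaussianSeq
      ({a | logMean (gaussianSeries a) r ≤ (1 / 2 - η) * r ^ 2} ∪
        {a | (1 / 2 + η) * (Real.exp t * r) ^ 2 ≤ logMean (gaussianSeries a) (Real.exp t * r)} ∪
        {a | (1 / 2 + η) * (Real.exp (-t) * r) ^ 2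
          ≤ logMean (gaussianSeries a) (Real.exp (-t) * r)}) := by
    refine measure_mono_ae ?_
    filter_upwards [ae_rapidDecay] with a ha hdev
    by_contra hn
    have hn' : ¬ ((logMean (gaussianSeries a) r ≤ (1 / 2 - η) * r ^ 2 ∨
        (1 / 2 + η) * (Real.exp t * r) ^ 2 ≤ logMean (gaussianSeries a) (Real.exp t * r)) ∨
        (1 / 2 + η) * (Real.exp (-t) * r) ^ 2
          ≤ logMean (gaussianSeries a) (Real.exp (-t) * r)) := hn
    simp only [not_or, not_le] at hn'
    exact absurd (show δ ≤ _ from hdev) (not_le.2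
      (abs_zeroCount_div_lt ha.differentiable hr hδ hδ' ht hη hn'.1.2 hn'.1.1 hn'.2))
  have hr4' : 0 < r ^ 4 := by positivity
  have key : ∀ y : ℝ, c₀ * r ^ 4 ≤ y → ENNReal.ofReal (Real.exp (-y))
      ≤ ENNReal.ofReal (Real.exp (-(c₀ * r ^ 4))) := fun y hy =>
    ENNReal.ofReal_le_ofReal (Real.exp_le_exp.2 (neg_le_neg hy))
  have kA := key (η ^ 2 / 16 * r ^ 4) (by
    have := min_le_left (η ^ 2 / 16) (Real.exp (-t) ^ 4)
    gcongr)
  have kC := key ((Real.exp (-t) * r) ^ 4) (by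
    rw [mul_pow]
    have := min_le_right (η ^ 2 / 16) (Real.exp (-t) ^ 4)
    gcongr)
  have kB := key ((Real.exp t * r) ^ 4) (by
    rw [mul_pow]
    have h1 := min_le_right (η ^ 2 / 16) (Real.exp (-t) ^ 4)
    have h2 : Real.exp (-t) ≤ Real.exp t := Real.exp_le_exp.2 (by rw [ht]; linarith)
    have h3 : Real.exp (-t) ^ 4 ≤ Real.exp t ^ 4 := by gcongr
    have := h1.trans h3
    gcongr)
  rw [neg_mul] at hA
  refine hsub.trans (((measure_union_le _ _).trans (add_le_add (measure_union_le _ _) le_rfl)).trans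
    ((add_le_add (add_le_add (hA.trans kA) (hB.trans kB)) (hC.trans kC)).trans ?_))
  rw [← ENNReal.ofReal_add (Real.exp_pos _).le (Real.exp_pos _).le,
    ← ENNReal.ofReal_add (by positivity) (Real.exp_pos _).le]
  refine ENNReal.ofReal_le_ofReal ?_
  have h3 : (3 : ℝ) ≤ Real.exp (c₀ / 2 * r ^ 4) := by
    rw [← Real.log_le_iff_le_exp (by norm_num)]
    rw [div_le_iff₀ (by positivity)] at hr4
    linarith
  calc _ = 3 * Real.exp (-(c₀ * r ^ 4)) := by ring
    _ ≤ Real.exp (c₀ / 2 * r ^ 4) * Real.exp (-(c₀ * r ^ 4)) := by gcongr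
    _ = Real.exp (-(c₀ / 2) * r ^ 4) := by rw [← Real.exp_add]; ring_nf

lemma exists_measure_deviationSet_le_of_le {δ : ℝ} (hδ' : δ ≤ 1 / 4) {R₀ : ℝ} (hR₀ : 1 ≤ R₀) :
    ∃ c : ℝ, 0 < c ∧ ∀ r : ℝ, 1 ≤ r → r ≤ R₀ → (∃ m : ℕ, |(m : ℝ) / r ^ 2 - 1| < δ) →
      gaussianSeq (deviationSet δ r) ≤ ENNReal.ofReal (Real.exp (-c * r ^ 4)) := by
  choose ε hε hprob using fun m : ℕ =>
    exists_measure_zeroCount_ne_le m (R₀ := R₀) (by linarith)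
  obtain ⟨M, hM⟩ := exists_nat_ge (2 * R₀ ^ 2)
  obtain ⟨m₀, -, hmin⟩ := Finset.exists_min_image (Finset.range (M + 1)) ε ⟨0, by simp⟩
  have hR4 : 0 < R₀ ^ 4 := by positivity
  refine ⟨ε m₀ / R₀ ^ 4, div_pos (hε m₀) hR4, fun r hr1 hrR ⟨m, hm⟩ => ?_⟩
  have hr2 : 0 < r ^ 2 := by positivity
  have hmM : m ∈ Finset.range (M + 1) := by
    have h1 : (m : ℝ) / r ^ 2 < 2 := by have := (abs_lt.1 hm).2; linarith
    rw [div_lt_iff₀ hr2] at h1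
    have h2 : r ^ 2 ≤ R₀ ^ 2 := by gcongr
    have h3 : (m : ℝ) < M + 1 := by linarith
    exact Finset.mem_range.2 (by exact_mod_cast h3)
  have hsub : deviationSet δ r ⊆ {a | zeroCount (gaussianSeries a) r ≠ m} := by
    intro a ha hcount
    have ha' : δ ≤ |(zeroCount (gaussianSeries a) r : ℝ) / r ^ 2 - 1| := ha
    rw [hcount] at ha'
    exact absurd hm (not_lt.2 ha')
  refine (measure_mono hsub).trans ((hprob m r hr1 hrR).trans (ENNReal.ofReal_le_ofReal ?_))
  have h4 : r ^ 4 ≤ R₀ ^ 4 := by gcongr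
  have h5 : ε m₀ / R₀ ^ 4 * r ^ 4 ≤ ε m := by
    calc ε m₀ / R₀ ^ 4 * r ^ 4 ≤ ε m₀ / R₀ ^ 4 * R₀ ^ 4 := by have := (hε m₀).le; gcongr
      _ = ε m₀ := by field_simp
      _ ≤ ε m := hmin m hmM
  have h6 := Real.add_one_le_exp (-(ε m₀ / R₀ ^ 4) * r ^ 4)
  linarith

theorem theorem2 (δ : ℝ) (hδ : 0 < δ) (hδ' : δ ≤ 1 / 4) :
    ∃ c : ℝ, 0 < c ∧
      ∀ (Ω : Type*) [MeasurableSpace Ω] (P : Measure Ω) [IsProbabilityMeasure P]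
        (ζ : ℕ → Ω → ℂ),
        (∀ k, HasLaw (ζ k) stdComplexGaussian P) → iIndepFun ζ P →
        ∀ r : ℝ, 1 ≤ r → (∃ m : ℕ, |(m : ℝ) / r ^ 2 - 1| < δ) →
          P {ω | δ ≤ |(zeroCount (gaussianSeries fun k => ζ k ω) r : ℝ) / r ^ 2 - 1|}
            ≤ ENNReal.ofReal (Real.exp (-c * r ^ 4)) := by
  obtain ⟨c₁, hc₁, hlarge⟩ := eventually_measure_deviationSet_le hδ hδ'
  obtain ⟨R, hR⟩ := Filter.eventually_atTop.1 hlarge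
  obtain ⟨c₂, hc₂, hsmall⟩ := exists_measure_deviationSet_le_of_le hδ' (le_max_right R 1)
  refine ⟨min c₁ c₂, lt_min hc₁ hc₂, fun Ω _ P _ ζ hlaw hind r hr hm => ?_⟩
  have hmeas : AEMeasurable (fun ω k => ζ k ω) P :=
    aemeasurable_pi_iff.2 fun k => (hlaw k).aemeasurable
  have hmap : P.map (fun ω k => ζ k ω) = gaussianSeq :=
    (iIndepFun.hasLaw_infinitePi hlaw hind hmeas).map_eq
  -- the deviation set need not be measurable, but a preimage never has larger outer measure
  have hle : P ((fun ω k => ζ k ω) ⁻¹' deviationSet δ r) ≤ gaussianSeq (deviationSet δ r) := by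
    rw [← hmap]
    exact Measure.le_map_apply hmeas _
  have hr4 : 0 ≤ r ^ 4 := by positivity
  refine hle.trans ?_
  rcases le_total R r with h | h
  · refine (hR r h).trans (ENNReal.ofReal_le_ofReal (Real.exp_le_exp.2 ?_))
    have := mul_le_mul_of_nonneg_right (min_le_left c₁ c₂) hr4
    linarith
  · refine (hsmall r hr (h.trans (le_max_left R 1)) hm).trans
      (ENNReal.ofReal_le_ofReal (Real.exp_le_exp.2 ?_))
    have := mul_le_mul_of_nonneg_right (min_le_right c₁ c₂) hr4
    linarith
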